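/- For an additive abelian group $G$, let $\mathcal B(G)$ be the monoid of zero-sum sequences over $G$, that is, the submonoid of the free abelian monoid with basis $G$ consisting of all finite (unordered) sequences $g_1\cdots g_\ell$ with $g_1+\dots+g_\ell=0$. An atom of $\mathcal B(G)$ is a non-unit that is not a product of two non-units. For a non-unit $A\in\mathcal B(G)$ let $\mathsf L(A)$ be the set of all $k\in\mathbb N$ such that $A$ is a product of $k$ atoms, and let $\mathsf L(A)=\{0\}$ if $A$ is the empty sequence (the only unit); put $\mathcal L(G)=\{\mathsf L(A)\mid A\in\mathcal B(G)\}$. Write $\mathbb N=\{1,2,\dots\}$, $\mathbb N_0=\mathbb N\cup\{0\}$, $[a,b]=\{x\in\mathbb Z\mid a\le x\le b\}$, $y+L=\{y+x\mid x\in L\}$ and $2\cdot L=\{2x\mid x\in L\}$. Let $C_n$ be the cyclic group of order $n$. Then $$\mathcal L(C_2\oplus C_4)=\mathcal L_1\cup\mathcal L_2\cup\mathcal L_3\cup\mathcal L_4\cup\mathcal L_5,$$ where \begin{align*} \mathcal L_1&=\{\{y\}\mid y\in\mathbb N_0\},\\ \mathcal L_2&=\{y+2\lceil k/3\rceil+[0,k]\mid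 y\in\mathbb N_0,\ k\in\mathbb N\setminus\{3\}\}\cup\{y+[3,6]\mid y\in\mathbb N_0\}\cup\{[2t+1,5t+2]\mid t\in\mathbb N\}\\ &=\{y+\lceil 2k/3\rceil+[0,k]\mid y\in\mathbb N_0,\ k\in\mathbb N\setminus\{1,3\}\}\cup\{y+3+[0,3],\ y+2+[0,1]\mid y\in\mathbb N_0\},\\ \mathcal L_3&=\{y+2k+2\cdot[0,k]\mid y\in\mathbb N_0,\ k\in\mathbb N\},\\ \mathcal L_4&=\{y+k+1+(\{0\}\cup[2,k+2])\mid y\in\mathbb N_0,\ k\in\mathbb N\text{ odd}\},\\ \mathcal L_5&=\{y+k+2+([0,k]\cup\{k+2\})\mid y\in\mathbb N_0,\ k\in\mathbb N\}. \end{align*} (The equality of the two descriptions of $\mathcal L_2$ is part of the claim.) -/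

import Mathlib

/-- The monoid `𝓑(G)` of zero-sum sequences over an (additive) abelian group `G`: the submonoid
of the free abelian monoid `Multiset G` consisting of the sequences whose terms sum to `0`. -/
def zeroSumMonoid (G : Type*) [AddCommGroup G] : AddSubmonoid (Multiset G) where
  carrier := {S | S.sum = 0}
  zero_mem' := Multiset.sum_zero
  add_mem' := fun {S T} hS hT => by
    have hS' : S.sum = 0 := hS
    have hT' : T.sum = 0 := hT
    change (S + T).sum = 0
    rw [Multiset.sum_add, hS', hT', add_zero]

/-- The set of lengths `𝖫(a)` of an element `a` of a commutative (additively written) monoid: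
all `k` such that `a` is a sum of `k` atoms if `a` is not a unit, and `{0}` if `a` is a unit. -/
def setOfLengths {H : Type*} [AddCommMonoid H] (a : H) : Set ℕ :=
  {k | (IsAddUnit a ∧ k = 0) ∨
    (¬ IsAddUnit a ∧ ∃ s : Multiset H, (∀ u ∈ s, AddIrreducible u) ∧ s.sum = a ∧ s.card = k)}

/-- The system of sets of lengths `𝓛(H) = {𝖫(a) ∣ a ∈ H}` of a commutative monoid `H`. -/
def systemOfSetsOfLengths (H : Type*) [AddCommMonoid H] : Set (Set ℕ) :=
  {L | ∃ a : H, L = setOfLengths a}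

/-- `𝓛(G) = 𝓛(𝓑(G))` for an abelian group `G`. -/
def groupSystemOfSetsOfLengths (G : Type*) [AddCommGroup G] : Set (Set ℕ) :=
  systemOfSetsOfLengths (zeroSumMonoid G)

/-- The shifted set `y + L`. -/
def shift (y : ℕ) (L : Set ℕ) : Set ℕ := (fun x => y + x) '' L

/-- The dilated set `m · L = {m x ∣ x ∈ L}`. -/
def dilate (m : ℕ) (L : Set ℕ) : Set ℕ := (fun x => m * x) '' L

/-- `{ {y} ∣ y ∈ ℕ₀ }`. -/
def family1 : Set (Set ℕ) := {L | ∃ y : ℕ, L = {y}}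

/-- `{ y + 2⌈k/3⌉ + [0,k] ∣ y ∈ ℕ₀, k ∈ ℕ ∖ {3} } ∪ { y + [3,6] ∣ y ∈ ℕ₀ }
∪ { [2t+1, 5t+2] ∣ t ∈ ℕ }`. -/
def family2 : Set (Set ℕ) :=
  {L | ∃ y k : ℕ, 1 ≤ k ∧ k ≠ 3 ∧ L = shift (y + 2 * ⌈(k : ℚ) / 3⌉₊) (Set.Icc 0 k)} ∪
  {L | ∃ y : ℕ, L = shift y (Set.Icc 3 6)} ∪
  {L | ∃ t : ℕ, 1 ≤ t ∧ L = Set.Icc (2 * t + 1) (5 * t + 2)}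

/-- `{ y + ⌈2k/3⌉ + [0,k] ∣ y ∈ ℕ₀, k ∈ ℕ ∖ {1,3} } ∪ { y + 3 + [0,3], y + 2 + [0,1] ∣ y ∈ ℕ₀ }`. -/
def family2' : Set (Set ℕ) :=
  {L | ∃ y k : ℕ, 1 ≤ k ∧ k ≠ 1 ∧ k ≠ 3 ∧ L = shift (y + ⌈(2 * k : ℚ) / 3⌉₊) (Set.Icc 0 k)} ∪
  {L | ∃ y : ℕ, L = shift (y + 3) (Set.Icc 0 3) ∨ L = shift (y + 2) (Set.Icc 0 1)}

/-- `{ y + 2k + 2 · [0,k] ∣ y ∈ ℕ₀, k ∈ ℕ }`. -/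
def family3 : Set (Set ℕ) :=
  {L | ∃ y k : ℕ, 1 ≤ k ∧ L = shift (y + 2 * k) (dilate 2 (Set.Icc 0 k))}

/-- `{ y + k + 1 + ({0} ∪ [2,k+2]) ∣ y ∈ ℕ₀, k ∈ ℕ odd }`. -/
def family4 : Set (Set ℕ) :=
  {L | ∃ y k : ℕ, Odd k ∧ L = shift (y + k + 1) ({0} ∪ Set.Icc 2 (k + 2))}

/-- `{ y + k + 2 + ([0,k] ∪ {k+2}) ∣ y ∈ ℕ₀, k ∈ ℕ }`. -/
def family5 : Set (Set ℕ) :=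
  {L | ∃ y k : ℕ, 1 ≤ k ∧ L = shift (y + k + 2) (Set.Icc 0 k ∪ {k + 2})}

/-!
Let `k ∈ 𝖫(A)` with `k + 1 ∉ 𝖫(A)` and `k < max 𝖫(A)`. Among the factorizations of `A` of length `k`
take one with as many factors `{x, -x}` as possible. If no two of its longer factors contained
opposite elements, an integer weight on the group would show that `k = max 𝖫(A)`. So there are two
such factors `U` and `V`. By maximality no pair `{x, -x}` with `x ∈ U` and `-x ∈ V` can be split off
from `U + V` such that an atom remains; up to automorphisms, and given that `3 ∉ 𝖫(U + V)`, this
leaves five possibilities for `{U, V}`. For each of them, the absence of factorizations of length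
`k + 1` leaves few possibilities for the remaining factors, and suitable weights show that either
all lengths have the parity of `k`, or `k + 2 = max 𝖫(A)`, or `𝖫(A)` is the interval from `k + 2` on
together with `k`. Without such a gap, `𝖫(A)` is an interval, whose ends have ratio at most `5 / 2`
because atoms different from `0` have lengths between `2` and `5`.
-/

/-! ### The families of sets -/

theorem Icc_subset_of_step {L : Set ℕ} {m M : ℕ} (hm : m ∈ L)
    (step : ∀ k ∈ L, m ≤ k → k < M → k + 1 ∈ L) : Set.Icc m M ⊆ L := by
  rintro x ⟨hx1, hx2⟩
  induction x, hx1 using Nat.le_induction with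
  | base => exact hm
  | succ x hx ih => exact step x (ih (by omega)) hx (by omega)

theorem shift_Icc (y a b : ℕ) : shift y (Set.Icc a b) = Set.Icc (y + a) (y + b) := by
  simp [shift]

theorem shift_singleton (y a : ℕ) : shift y {a} = {y + a} :=
  Set.image_singleton

theorem shift_union (y : ℕ) (L M : Set ℕ) : shift y (L ∪ M) = shift y L ∪ shift y M :=
  Set.image_union _ _ _

theorem shift_shift (y z : ℕ) (L : Set ℕ) : shift y (shift z L) = shift (y + z) L := by
  simp only [shift, Set.image_image, add_assoc]

theorem ceil_div_three (k : ℕ) : ⌈(k : ℚ) / 3⌉₊ = (k + 2) / 3 := by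
  refine eq_of_forall_ge_iff fun c => ?_
  rw [Nat.ceil_le, div_le_iff₀ (by norm_num)]
  have : (k : ℚ) ≤ c * 3 ↔ k ≤ c * 3 := by exact_mod_cast Iff.rfl
  rw [this]
  omega

theorem ceil_two_mul_div_three (k : ℕ) : ⌈(2 * k : ℚ) / 3⌉₊ = (2 * k + 2) / 3 := by
  have := ceil_div_three (2 * k)
  push_cast at this
  exact this

theorem mem_family2_iff {L : Set ℕ} : L ∈ family2 ↔
    ∃ m M, m < M ∧ 2 * M ≤ 5 * m ∧ m ≠ 1 ∧ ¬ (m = 2 ∧ M = 5) ∧ L = Set.Icc m M := by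
  simp only [family2, Set.mem_union, Set.mem_ofPred_eq, shift_Icc, ceil_div_three]
  constructor
  · rintro ((⟨y, k, hk, hk3, rfl⟩ | ⟨y, rfl⟩) | ⟨t, ht, rfl⟩)
    · exact ⟨_, _, by omega, by omega, by omega, by omega, rfl⟩
    · exact ⟨_, _, by omega, by omega, by omega, by omega, rfl⟩
    · exact ⟨_, _, by omega, by omega, by omega, by omega, rfl⟩
  · rintro ⟨m, M, h1, h2, h3, h4, rfl⟩
    by_cases h : M = m + 3
    · exact Or.inl (Or.inr ⟨m - 3, by congr 1 <;> omega⟩)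
    by_cases h' : 2 * ((M - m + 2) / 3) ≤ m
    · exact Or.inl (Or.inl ⟨m - 2 * ((M - m + 2) / 3), M - m, by omega, by omega,
        by congr 1 <;> omega⟩)
    · exact Or.inr ⟨(m - 1) / 2, by omega, by congr 1 <;> omega⟩

theorem mem_family2'_iff {L : Set ℕ} : L ∈ family2' ↔
    ∃ m M, m < M ∧ 2 * M ≤ 5 * m ∧ m ≠ 1 ∧ ¬ (m = 2 ∧ M = 5) ∧ L = Set.Icc m M := by
  simp only [family2', Set.mem_union, Set.mem_ofPred_eq, shift_Icc, ceil_two_mul_div_three]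
  constructor
  · rintro (⟨y, k, hk, hk1, hk3, rfl⟩ | ⟨y, rfl | rfl⟩)
    · exact ⟨_, _, by omega, by omega, by omega, by omega, rfl⟩
    · exact ⟨_, _, by omega, by omega, by omega, by omega, rfl⟩
    · exact ⟨_, _, by omega, by omega, by omega, by omega, rfl⟩
  · rintro ⟨m, M, h1, h2, h3, h4, rfl⟩
    by_cases h : M = m + 3
    · exact Or.inr ⟨m - 3, Or.inl (by congr 1 <;> omega)⟩
    by_cases h' : M = m + 1
    · exact Or.inr ⟨m - 2, Or.inr (by congr 1 <;> omega)⟩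
    exact Or.inl ⟨m - (2 * (M - m) + 2) / 3, M - m, by omega, by omega, by omega,
      by congr 1 <;> omega⟩

theorem family2_eq : family2 = family2' := by
  ext L
  rw [mem_family2_iff, mem_family2'_iff]

theorem mem_family3_iff {L : Set ℕ} : L ∈ family3 ↔
    ∃ m M, m < M ∧ M ≤ 2 * m ∧ M % 2 = m % 2 ∧ L = {x | m ≤ x ∧ x ≤ M ∧ x % 2 = m % 2} := by
  have hset : ∀ y k, shift y (dilate 2 (Set.Icc 0 k)) =
      {x | y ≤ x ∧ x ≤ y + 2 * k ∧ x % 2 = y % 2} := by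
    intro y k
    ext x
    simp only [shift, dilate, Set.mem_image, Set.mem_Icc, Set.mem_ofPred_eq]
    constructor
    · rintro ⟨_, ⟨z, hz, rfl⟩, rfl⟩
      omega
    · intro h
      exact ⟨_, ⟨(x - y) / 2, by omega, rfl⟩, by omega⟩
  simp only [family3, Set.mem_ofPred_eq, hset]
  constructor
  · rintro ⟨y, k, hk, rfl⟩
    exact ⟨_, _, by omega, by omega, by omega, rfl⟩
  · rintro ⟨m, M, h1, h2, h3, rfl⟩
    refine ⟨2 * m - M, (M - m) / 2, by omega, ?_⟩
    rw [show 2 * m - M + 2 * ((M - m) / 2) = m by omega, show m + 2 * ((M - m) / 2) = M by omega]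

theorem mem_family4_iff {L : Set ℕ} : L ∈ family4 ↔
    ∃ m M, m + 3 ≤ M ∧ M ≤ 2 * m + 1 ∧ M % 2 ≠ m % 2 ∧ L = {m} ∪ Set.Icc (m + 2) M := by
  have hset : ∀ y k, shift y ({0} ∪ Set.Icc 2 k) = {y} ∪ Set.Icc (y + 2) (y + k) := by
    intro y k
    rw [shift_union, shift_singleton, shift_Icc, add_zero]
  simp only [family4, Set.mem_ofPred_eq, hset]
  constructor
  · rintro ⟨y, k, ⟨j, hj⟩, rfl⟩
    exact ⟨_, _, by omega, by omega, by omega, rfl⟩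
  · rintro ⟨m, M, h1, h2, h3, rfl⟩
    refine ⟨2 * m + 1 - M, M - m - 2, Nat.odd_iff.2 (by omega), ?_⟩
    rw [show 2 * m + 1 - M + (M - m - 2) + 1 = m by omega, show m + (M - m - 2 + 2) = M by omega]

theorem mem_family5_iff {L : Set ℕ} : L ∈ family5 ↔
    ∃ m M, m + 1 ≤ M ∧ M + 2 ≤ 2 * m ∧ L = Set.Icc m M ∪ {M + 2} := by
  have hset : ∀ y k, shift y (Set.Icc 0 k ∪ {k + 2}) = Set.Icc y (y + k) ∪ {y + k + 2} := by
    intro y k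
    rw [shift_union, shift_singleton, shift_Icc, add_zero, add_assoc]
  simp only [family5, Set.mem_ofPred_eq, hset]
  constructor
  · rintro ⟨y, k, hk, rfl⟩
    exact ⟨_, _, by omega, by omega, rfl⟩
  · rintro ⟨m, M, h1, h2, rfl⟩
    refine ⟨2 * m - M - 2, M - m, by omega, ?_⟩
    rw [show 2 * m - M - 2 + (M - m) + 2 = m by omega, show m + (M - m) = M by omega]

/-! ### Weights and factorizations -/

section Weight

variable {G : Type*}

/-- The total weight of the terms of a sequence. -/
def weight (w : G → ℕ) (A : Multiset G) : ℕ := (A.map w).sum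

@[simp]
theorem weight_add (w : G → ℕ) (A B : Multiset G) : weight w (A + B) = weight w A + weight w B := by
  simp [weight]

theorem weight_nsmul (w : G → ℕ) (n : ℕ) (A : Multiset G) :
    weight w (n • A) = n * weight w A := by
  simp [weight, Multiset.map_nsmul, Multiset.sum_nsmul]

theorem weight_sum (w : G → ℕ) (Z : Multiset (Multiset G)) :
    weight w Z.sum = (Z.map (weight w)).sum := by
  induction Z using Multiset.induction with
  | empty => simp [weight]
  | cons U Z ih => simp [ih]

end Weight

section General

variable {G H : Type*} [AddCommGroup G] [AddCommGroup H]

/-- A minimal zero-sum sequence: these are the atoms of `𝓑(G)`, see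
`addIrreducible_iff_isMinZeroSum`. -/
structure IsMinZeroSum (U : Multiset G) : Prop where
  ne_zero : U ≠ 0
  sum_eq_zero : U.sum = 0
  eq_of_le : ∀ V ≤ U, V ≠ 0 → V.sum = 0 → V = U

/-- The set of lengths of a zero-sum sequence, computed among plain multisets; the empty sequence
has the empty factorization, so no case distinction is needed. -/
def lengths (A : Multiset G) : Set ℕ :=
  {k | ∃ Z : Multiset (Multiset G), (∀ U ∈ Z, IsMinZeroSum U) ∧ Z.sum = A ∧ Z.card = k}

theorem lengths_zero : lengths (0 : Multiset G) = {0} := by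
  refine Set.Subset.antisymm ?_ (Set.singleton_subset_iff.2 ⟨0, by simp⟩)
  rintro _ ⟨Z, hZ, hsum, rfl⟩
  rw [Set.mem_singleton_iff, Multiset.card_eq_zero, Multiset.eq_zero_iff_forall_notMem]
  exact fun U hU => (hZ U hU).ne_zero (Multiset.sum_eq_zero_iff.1 hsum U hU)

theorem isAddUnit_iff_val_eq_zero {u : zeroSumMonoid G} : IsAddUnit u ↔ u.1 = 0 := by
  refine ⟨fun h => ?_, fun h => (Subtype.ext h : u = 0) ▸ isAddUnit_zero⟩
  obtain ⟨v, hv⟩ := isAddUnit_iff_exists_neg.1 h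
  exact (add_eq_zero.1 (congrArg Subtype.val hv : u.1 + v.1 = 0)).1

theorem addIrreducible_iff_isMinZeroSum {u : zeroSumMonoid G} :
    AddIrreducible u ↔ IsMinZeroSum u.1 := by
  constructor
  · intro hu
    refine ⟨fun h => hu.not_isAddUnit (isAddUnit_iff_val_eq_zero.2 h), u.2,
      fun V hV hV0 hVs => ?_⟩
    obtain ⟨W, hW⟩ := Multiset.le_iff_exists_add.1 hV
    have hWs : W.sum = 0 := by
      have : u.1.sum = 0 := u.2
      rwa [hW, Multiset.sum_add, hVs, zero_add] at this
    have hsplit : u = (⟨V, hVs⟩ : zeroSumMonoid G) + ⟨W, hWs⟩ := Subtype.ext hW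
    rcases hu.isAddUnit_or_isAddUnit hsplit with h | h
    · exact absurd (isAddUnit_iff_val_eq_zero.1 h) hV0
    · rw [hW, show W = 0 from isAddUnit_iff_val_eq_zero.1 h, add_zero]
  · intro hu
    refine ⟨fun h => hu.ne_zero (isAddUnit_iff_val_eq_zero.1 h), fun {a b} hab => ?_⟩
    have hsum : u.1 = a.1 + b.1 := congrArg Subtype.val hab
    by_cases ha : a.1 = 0
    · exact Or.inl (isAddUnit_iff_val_eq_zero.2 ha)
    · have := hu.eq_of_le a.1 (hsum ▸ Multiset.le_add_right _ _) ha a.2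
      rw [← this, left_eq_add] at hsum
      exact Or.inr (isAddUnit_iff_val_eq_zero.2 hsum)

theorem setOfLengths_eq_lengths (a : zeroSumMonoid G) : setOfLengths a = lengths a.1 := by
  have hmem_iff (k : ℕ) : k ∈ lengths a.1 ↔ ∃ s : Multiset (zeroSumMonoid G),
      (∀ u ∈ s, AddIrreducible u) ∧ s.sum = a ∧ s.card = k := by
    constructor
    · rintro ⟨Z, hZ, hsum, rfl⟩
      lift Z to Multiset (zeroSumMonoid G) using fun U hU => (hZ U hU).sum_eq_zero
      refine ⟨Z, fun u hu => ?_, Subtype.ext ?_, (Multiset.card_map _ _).symm⟩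
      · exact addIrreducible_iff_isMinZeroSum.2 (hZ _ (Multiset.mem_map_of_mem _ hu))
      · rw [← hsum, ← AddSubmonoid.coe_subtype, map_multiset_sum]
    · rintro ⟨s, hs, rfl, rfl⟩
      refine ⟨s.map (↑), ?_, ?_, Multiset.card_map _ _⟩
      · simp only [Multiset.mem_map]
        rintro _ ⟨u, hu, rfl⟩
        exact addIrreducible_iff_isMinZeroSum.1 (hs u hu)
      · exact (map_multiset_sum (zeroSumMonoid G).subtype s).symm
  ext k
  by_cases ha : IsAddUnit a
  · have h0 : a.1 = 0 := isAddUnit_iff_val_eq_zero.1 ha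
    simp only [setOfLengths, ha, true_and, not_true_eq_false, false_and, or_false,
      Set.mem_ofPred_eq]
    rw [h0, lengths_zero, Set.mem_singleton_iff]
  · simp [setOfLengths, ha, hmem_iff]

theorem exists_isMinZeroSum_le {A : Multiset G} (h0 : A ≠ 0) (hA : A.sum = 0) :
    ∃ U ≤ A, IsMinZeroSum U := by
  obtain ⟨U, hUA, hU⟩ := exists_minimal_le_of_wellFoundedLT
    (fun V : Multiset G => V ≠ 0 ∧ V.sum = 0) A ⟨h0, hA⟩
  exact ⟨U, hUA, hU.prop.1, hU.prop.2,
    fun V hV hV0 hVs => le_antisymm hV (hU.le_of_le ⟨hV0, hVs⟩ hV)⟩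

theorem sum_eq_zero_of_mem_lengths {A : Multiset G} {k : ℕ} (h : k ∈ lengths A) : A.sum = 0 := by
  obtain ⟨Z, hZ, rfl, -⟩ := h
  rw [← Multiset.coe_sumAddMonoidHom, map_multiset_sum]
  refine Multiset.sum_eq_zero fun x hx => ?_
  obtain ⟨U, hU, rfl⟩ := Multiset.mem_map.1 hx
  exact (hZ U hU).sum_eq_zero

theorem zero_mem_lengths {A : Multiset G} : 0 ∈ lengths A ↔ A = 0 := by
  constructor
  · rintro ⟨Z, -, rfl, hZ⟩
    rw [Multiset.card_eq_zero.1 hZ, Multiset.sum_zero]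
  · rintro rfl
    exact lengths_zero.ge rfl

theorem one_mem_lengths {A : Multiset G} : 1 ∈ lengths A ↔ IsMinZeroSum A := by
  constructor
  · rintro ⟨Z, hZ, rfl, hcard⟩
    obtain ⟨U, rfl⟩ := Multiset.card_eq_one.1 hcard
    simpa using hZ
  · exact fun hA => ⟨{A}, by simpa, by simp⟩

theorem add_mem_lengths {A B : Multiset G} {k l : ℕ} (hk : k ∈ lengths A) (hl : l ∈ lengths B) :
    k + l ∈ lengths (A + B) := by
  obtain ⟨Y, hY, rfl, rfl⟩ := hk
  obtain ⟨Z, hZ, rfl, rfl⟩ := hl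
  refine ⟨Y + Z, fun U hU => ?_, Multiset.sum_add _ _, Multiset.card_add _ _⟩
  exact (Multiset.mem_add.1 hU).elim (hY U) (hZ U)

theorem nsmul_mem_lengths {A : Multiset G} {k : ℕ} (hk : k ∈ lengths A) (n : ℕ) :
    n * k ∈ lengths (n • A) := by
  induction n with
  | zero => simpa using zero_mem_lengths.2 rfl
  | succ n ih => rw [succ_nsmul, add_one_mul]; exact add_mem_lengths ih hk

theorem succ_mem_lengths [DecidableEq G] {A : Multiset G} {n : ℕ} :
    n + 1 ∈ lengths A ↔ ∃ U, IsMinZeroSum U ∧ U ≤ A ∧ n ∈ lengths (A - U) := by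
  constructor
  · rintro ⟨Z, hZ, rfl, hcard⟩
    obtain ⟨U, hU⟩ := Multiset.card_pos_iff_exists_mem.1 (by omega : 0 < Z.card)
    obtain ⟨Y, rfl⟩ := Multiset.exists_cons_of_mem hU
    rw [Multiset.forall_mem_cons] at hZ
    rw [Multiset.card_cons, Nat.add_right_cancel_iff] at hcard
    rw [Multiset.sum_cons]
    exact ⟨U, hZ.1, Multiset.le_add_right _ _, Y, hZ.2, by rw [add_tsub_cancel_left],
      hcard⟩
  · rintro ⟨U, hU, hle, hn⟩
    rw [← Multiset.sub_add_cancel hle]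
    exact add_mem_lengths hn (one_mem_lengths.2 hU)

theorem IsMinZeroSum.lengths_eq {U : Multiset G} (hU : IsMinZeroSum U) : lengths U = {1} := by
  classical
  refine Set.Subset.antisymm (fun k hk => ?_) (Set.singleton_subset_iff.2 (one_mem_lengths.2 hU))
  cases k with
  | zero => exact absurd (zero_mem_lengths.1 hk) hU.ne_zero
  | succ n =>
    obtain ⟨V, hV, hle, hn⟩ := succ_mem_lengths.1 hk
    obtain rfl := hU.eq_of_le V hle hV.ne_zero hV.sum_eq_zero
    rw [tsub_self, lengths_zero, Set.mem_singleton_iff] at hn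
    rw [hn, Set.mem_singleton_iff]

theorem lengths_nonempty {A : Multiset G} (hA : A.sum = 0) : (lengths A).Nonempty := by
  classical
  induction A using Multiset.strongInductionOn with
  | ih A ih =>
    by_cases h0 : A = 0
    · exact ⟨0, zero_mem_lengths.2 h0⟩
    obtain ⟨U, hle, hU⟩ := exists_isMinZeroSum_le h0 hA
    obtain ⟨B, rfl⟩ := Multiset.le_iff_exists_add.1 hle
    rw [Multiset.sum_add, hU.sum_eq_zero, zero_add] at hA
    obtain ⟨k, hk⟩ := ih B (lt_add_of_pos_left B (bot_lt_iff_ne_bot.2 hU.ne_zero)) hA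
    exact ⟨1 + k, add_mem_lengths (one_mem_lengths.2 hU) hk⟩

theorem isMinZeroSum_singleton_zero : IsMinZeroSum ({0} : Multiset G) :=
  ⟨by simp, by simp, fun V hV hV0 _ => (Multiset.le_singleton.1 hV).resolve_left hV0⟩

theorem lengths_add_zero (A : Multiset G) : lengths (A + {0}) = shift 1 (lengths A) := by
  ext k
  constructor
  · rintro ⟨Z, hZ, hsum, rfl⟩
    have h0 : (0 : G) ∈ Z.join := by simp [Multiset.join, hsum]
    obtain ⟨U, hU, h0U⟩ := Multiset.mem_join.1 h0
    obtain rfl : {0} = U := (hZ U hU).eq_of_le _ (Multiset.singleton_le.2 h0U) (by simp) (by simp)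
    obtain ⟨Y, rfl⟩ := Multiset.exists_cons_of_mem hU
    rw [Multiset.sum_cons, add_comm A] at hsum
    rw [Multiset.forall_mem_cons] at hZ
    exact ⟨Y.card, ⟨Y, hZ.2, add_left_cancel hsum, rfl⟩, by simp [add_comm]⟩
  · rintro ⟨l, hl, rfl⟩
    rw [add_comm A]
    exact add_mem_lengths (one_mem_lengths.2 isMinZeroSum_singleton_zero) hl

theorem lengths_add_nsmul_zero (A : Multiset G) (y : ℕ) :
    lengths (A + y • {0}) = shift y (lengths A) := by
  induction y with
  | zero => simp [shift]
  | succ y ih =>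
    rw [succ_nsmul, ← add_assoc, lengths_add_zero, ih, shift_shift, add_comm]

theorem shift_mem_of_lengths_eq {A : Multiset G} {L : Set ℕ} (h : lengths A = L)
    (hL : L.Nonempty) (y : ℕ) : shift y L ∈ groupSystemOfSetsOfLengths G := by
  obtain ⟨k, hk⟩ := hL
  have hA : A.sum = 0 := sum_eq_zero_of_mem_lengths (h.ge hk)
  refine ⟨⟨A + y • {0}, ?_⟩, ?_⟩
  · change (A + y • {0}).sum = 0
    simp [hA, Multiset.sum_nsmul]
  · rw [setOfLengths_eq_lengths, lengths_add_nsmul_zero, h]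

theorem IsMinZeroSum.map (φ : G ≃+ H) {U : Multiset G} (hU : IsMinZeroSum U) :
    IsMinZeroSum (U.map φ) := by
  refine ⟨by simpa using hU.ne_zero, ?_, fun V hV hV0 hVs => ?_⟩
  · rw [← map_multiset_sum, hU.sum_eq_zero, map_zero]
  have hVφ : (V.map φ.symm).map φ = V := by simp [Multiset.map_map]
  have hle : V.map φ.symm ≤ U := by
    simpa [Multiset.map_map] using Multiset.map_le_map (f := φ.symm) hV
  rw [← hVφ, hU.eq_of_le _ hle (by simpa) (by rw [← map_multiset_sum, hVs, map_zero])]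

theorem sum_map_map {α β : Type*} (f : α → β) (Z : Multiset (Multiset α)) :
    (Z.map (Multiset.map f)).sum = Z.sum.map f :=
  (map_multiset_sum (Multiset.mapAddMonoidHom f) Z).symm

theorem lengths_subset_lengths_map (φ : G ≃+ H) (A : Multiset G) :
    lengths A ⊆ lengths (A.map φ) := by
  rintro _ ⟨Z, hZ, rfl, rfl⟩
  refine ⟨Z.map (Multiset.map φ), ?_, ?_, Multiset.card_map _ _⟩
  · simp only [Multiset.mem_map]
    rintro _ ⟨U, hU, rfl⟩
    exact (hZ U hU).map φ
  · exact sum_map_map φ Z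

theorem lengths_map (φ : G ≃+ H) (A : Multiset G) : lengths (A.map φ) = lengths A := by
  refine (lengths_subset_lengths_map φ A).antisymm' ?_
  simpa [Multiset.map_map] using lengths_subset_lengths_map φ.symm (A.map φ)

theorem mul_le_weight {w : G → ℕ} {A : Multiset G} {c k : ℕ}
    (hw : ∀ U ≤ A, IsMinZeroSum U → c ≤ weight w U) (hk : k ∈ lengths A) :
    k * c ≤ weight w A := by
  obtain ⟨Z, hZ, rfl, rfl⟩ := hk
  have hc : ∀ x ∈ Z.map (weight w), c ≤ x := by
    simp only [Multiset.mem_map]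
    rintro _ ⟨U, hU, rfl⟩
    exact hw U (Multiset.le_sum_of_mem hU) (hZ U hU)
  simpa [weight_sum] using Multiset.card_nsmul_le_sum hc

theorem weight_le_mul {w : G → ℕ} {A : Multiset G} {c k : ℕ}
    (hw : ∀ U ≤ A, IsMinZeroSum U → weight w U ≤ c) (hk : k ∈ lengths A) :
    weight w A ≤ k * c := by
  obtain ⟨Z, hZ, rfl, rfl⟩ := hk
  have hc : ∀ x ∈ Z.map (weight w), x ≤ c := by
    simp only [Multiset.mem_map]
    rintro _ ⟨U, hU, rfl⟩
    exact hw U (Multiset.le_sum_of_mem hU) (hZ U hU)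
  simpa [weight_sum] using Multiset.sum_le_card_nsmul _ c hc

theorem weight_modEq {w : G → ℕ} {A : Multiset G} {c n k : ℕ}
    (hw : ∀ U ≤ A, IsMinZeroSum U → weight w U ≡ c [MOD n]) (hk : k ∈ lengths A) :
    weight w A ≡ k * c [MOD n] := by
  obtain ⟨Z, hZ, rfl, rfl⟩ := hk
  have hc : ∀ U ∈ Z, weight w U ≡ c [MOD n] := fun U hU =>
    hw U (Multiset.le_sum_of_mem hU) (hZ U hU)
  clear hw hZ
  induction Z using Multiset.induction with
  | empty => simp [weight, Nat.ModEq.refl]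
  | cons U Z ih =>
    rw [Multiset.forall_mem_cons] at hc
    rw [Multiset.sum_cons, weight_add, Multiset.card_cons, add_one_mul, add_comm]
    exact (ih hc.2).add hc.1

theorem bddAbove_lengths (A : Multiset G) : BddAbove (lengths A) := by
  refine ⟨A.card, fun k hk => ?_⟩
  have hcard : ∀ U ≤ A, IsMinZeroSum U → 1 ≤ weight (fun _ => 1) U := fun U _ hU => by
    simpa [weight, Nat.one_le_iff_ne_zero] using hU.ne_zero
  simpa [weight] using mul_le_weight hcard hk

/-- The number of factors of length two in a factorization. -/
def pairCount (Z : Multiset (Multiset G)) : ℕ := Z.countP (·.card = 2)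

/-- A factorization of a sequence that has neither a factorization with one more factor nor one with
the same number of factors and more factors of length two. Stability passes to subfamilies (see
`IsStableFactorization.of_le`), so local exchanges suffice to exploit it. -/
structure IsStableFactorization (Z : Multiset (Multiset G)) : Prop where
  isMinZeroSum : ∀ U ∈ Z, IsMinZeroSum U
  succ_notMem : Z.card + 1 ∉ lengths Z.sum
  pairCount_le : ∀ Y : Multiset (Multiset G), (∀ U ∈ Y, IsMinZeroSum U) → Y.sum = Z.sum →
    Y.card = Z.card → pairCount Y ≤ pairCount Z

theorem exists_isStableFactorization {A : Multiset G} {k : ℕ} (hk : k ∈ lengths A)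
    (hk' : k + 1 ∉ lengths A) :
    ∃ Z, IsStableFactorization Z ∧ Z.sum = A ∧ Z.card = k := by
  let S : Set ℕ := {p | ∃ Z : Multiset (Multiset G), ((∀ U ∈ Z, IsMinZeroSum U) ∧ Z.sum = A ∧
    Z.card = k) ∧ pairCount Z = p}
  have hne : S.Nonempty := let ⟨Z, hZ⟩ := hk; ⟨_, Z, hZ, rfl⟩
  have hbdd : BddAbove S :=
    ⟨k, by rintro _ ⟨Z, ⟨-, -, rfl⟩, rfl⟩; exact Multiset.countP_le_card _ _⟩
  obtain ⟨Z, ⟨hZ, rfl, rfl⟩, hmax⟩ := Nat.sSup_mem hne hbdd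
  exact ⟨Z, ⟨hZ, hk', fun Y hY hsum hcard => hmax ▸ le_csSup hbdd ⟨Y, ⟨hY, hsum, hcard⟩, rfl⟩⟩,
    rfl, rfl⟩

theorem IsStableFactorization.of_le {Y Z : Multiset (Multiset G)} (hZ : IsStableFactorization Z)
    (hle : Y ≤ Z) :
    IsStableFactorization Y := by
  obtain ⟨R, rfl⟩ := Multiset.le_iff_exists_add.1 hle
  have hR : ∀ U ∈ R, IsMinZeroSum U := fun U hU => hZ.isMinZeroSum U (Multiset.mem_add.2 (.inr hU))
  refine ⟨fun U hU => hZ.isMinZeroSum U (Multiset.mem_of_le hle hU), fun h => hZ.succ_notMem ?_,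
    fun X hX hsum hcard => ?_⟩
  · rw [Multiset.sum_add, Multiset.card_add, add_right_comm]
    exact add_mem_lengths h ⟨R, hR, rfl, rfl⟩
  · have := hZ.pairCount_le (X + R)
      (fun U hU => (Multiset.mem_add.1 hU).elim (hX U) (hR U)) (by simp [hsum]) (by simp [hcard])
    simpa [pairCount] using this

theorem IsStableFactorization.map (φ : G ≃+ H) {Z : Multiset (Multiset G)}
    (hZ : IsStableFactorization Z) :
    IsStableFactorization (Z.map (Multiset.map φ)) := by
  have hinv : (Z.map (Multiset.map φ)).map (Multiset.map φ.symm) = Z := by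
    simp [Multiset.map_map]
  refine ⟨?_, ?_, fun Y hY hsum hcard => ?_⟩
  · simp only [Multiset.mem_map]
    rintro _ ⟨U, hU, rfl⟩
    exact (hZ.isMinZeroSum U hU).map φ
  · rw [sum_map_map, lengths_map, Multiset.card_map]
    exact hZ.succ_notMem
  · have := hZ.pairCount_le (Y.map (Multiset.map φ.symm)) ?_ ?_ (by simpa using hcard)
    · simpa [pairCount, Multiset.countP_map, ← Multiset.countP_eq_card_filter] using this
    · simp only [Multiset.mem_map]
      rintro _ ⟨U, hU, rfl⟩
      exact (hY U hU).map φ.symm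
    · rw [sum_map_map, hsum, ← sum_map_map, hinv]

end General

/-! ### Atoms over `C₂ ⊕ C₄` -/

/-- The group `C₂ ⊕ C₄`. -/
abbrev C2C4 : Type := ZMod 2 × ZMod 4

/-- The elements of `C₂ ⊕ C₄`, numbered such that `elt n = (⌊n / 4⌋, n)` for `n < 8`: the elements
of order four are `1`, `3 = -1`, `5`, `7 = -5`, those of order two are `2`, `4`, `6`. (The
components are not written as casts because casts evaluate slowly in the kernel.) -/
def elt (n : ℕ) : C2C4 := (Fin.ofNat 2 (n / 4), Fin.ofNat 4 n)

/-- The sequence over `C₂ ⊕ C₄` whose terms have the given numbers. -/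
def seq (l : List ℕ) : Multiset C2C4 := (l.map elt : List C2C4)

/-- The minimal zero-sum sequences over `C₂ ⊕ C₄`, see `isMinZeroSum_iff_mem_atoms`. -/
def atoms : List (Multiset C2C4) :=
  [[0],
    [1, 3], [5, 7], [2, 2], [4, 4], [6, 6],
    [1, 1, 2], [2, 3, 3], [2, 5, 5], [2, 7, 7], [1, 4, 7], [1, 5, 6], [3, 4, 5], [3, 6, 7],
    [2, 4, 6],
    [1, 1, 1, 1], [3, 3, 3, 3], [5, 5, 5, 5], [7, 7, 7, 7],
    [1, 1, 5, 5], [1, 1, 7, 7], [3, 3, 5, 5], [3, 3, 7, 7],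
    [1, 1, 4, 6], [3, 3, 4, 6], [4, 5, 5, 6], [4, 6, 7, 7],
    [1, 2, 4, 5], [1, 2, 6, 7], [2, 3, 4, 7], [2, 3, 5, 6],
    [1, 1, 1, 4, 5], [1, 1, 1, 6, 7], [3, 3, 3, 4, 7], [3, 3, 3, 5, 6],
    [1, 4, 5, 5, 5], [1, 6, 7, 7, 7], [3, 4, 7, 7, 7], [3, 5, 5, 5, 6]].map seq

/-- The sequence over `C₂ ⊕ C₄` in which `elt n` has multiplicity `c n` for `n < 8`. -/
def ofCounts (c : ℕ → ℕ) : Multiset C2C4 :=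
  ∑ n ∈ Finset.range 8, Multiset.replicate (c n) (elt n)

theorem ofCounts_count (A : Multiset C2C4) : ofCounts (fun n => A.count (elt n)) = A := by
  have hinj : Set.InjOn elt (Finset.range 8) := by
    simp only [Set.InjOn, Finset.mem_coe, Finset.mem_range]
    decide
  rw [ofCounts, ← Finset.sum_image (f := fun g => Multiset.replicate (A.count g) g) hinj,
    show (Finset.range 8).image elt = Finset.univ by decide]
  ext g
  simp [Multiset.count_sum', Multiset.count_replicate]

theorem ofCounts_congr {c d : ℕ → ℕ} (h : ∀ n < 8, c n = d n) : ofCounts c = ofCounts d :=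
  Finset.sum_congr rfl fun n hn => by rw [h n (Finset.mem_range.1 hn)]

/-- The pairs of multiplicities that `g` and `-g` can have in a zero-sum free sequence if `g` has
order four. -/
def oppositeCounts : Finset (ℕ × ℕ) := {p ∈ Finset.range 4 ×ˢ Finset.range 4 | p.1 = 0 ∨ p.2 = 0}

theorem exists_mem_atoms_le_ofCounts : ∀ p ∈ oppositeCounts, ∀ q ∈ oppositeCounts,
    ∀ r ∈ Finset.range 2 ×ˢ Finset.range 2 ×ˢ Finset.range 2,
      (ofCounts ([0, p.1, r.1, p.2, r.2.1, q.1, r.2.2, q.2].getD · 0)).sum = 0 →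
      ofCounts ([0, p.1, r.1, p.2, r.2.1, q.1, r.2.2, q.2].getD · 0) = 0 ∨
        ∃ U ∈ atoms, U ≤ ofCounts ([0, p.1, r.1, p.2, r.2.1, q.1, r.2.2, q.2].getD · 0) := by
  decide +kernel

theorem exists_mem_atoms_le {A : Multiset C2C4} (h0 : A ≠ 0) (hA : A.sum = 0) :
    ∃ U ∈ atoms, U ≤ A := by
  by_contra! hno
  have hcount (n k : ℕ) (h : Multiset.replicate k (elt n) ∈ atoms) : A.count (elt n) < k := by
    by_contra! hk
    exact hno _ h (Multiset.le_count_iff_replicate_le.1 hk)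
  have hopp (m n : ℕ) (hm : Multiset.replicate 4 (elt m) ∈ atoms)
      (hn : Multiset.replicate 4 (elt n) ∈ atoms) (h : {elt m, elt n} ∈ atoms)
      (hne : elt m ≠ elt n) : (A.count (elt m), A.count (elt n)) ∈ oppositeCounts := by
    have hor : A.count (elt m) = 0 ∨ A.count (elt n) = 0 := by
      by_contra! hmn
      refine hno _ h ((Multiset.le_iff_subset (by simpa using hne)).2 ?_)
      simpa [Multiset.subset_iff] using
        ⟨Multiset.count_ne_zero.1 hmn.1, Multiset.count_ne_zero.1 hmn.2⟩
    simp only [oppositeCounts, Finset.mem_filter, Finset.mem_product, Finset.mem_range]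
    exact ⟨⟨hcount m 4 hm, hcount n 4 hn⟩, hor⟩
  have hA' : ofCounts ([0, A.count (elt 1), A.count (elt 2), A.count (elt 3), A.count (elt 4),
      A.count (elt 5), A.count (elt 6), A.count (elt 7)].getD · 0) = A := by
    have h00 : A.count (elt 0) = 0 := Nat.lt_one_iff.1 (hcount 0 1 (by decide))
    refine (ofCounts_congr fun n hn => ?_).trans (ofCounts_count A)
    interval_cases n
    · exact h00.symm
    all_goals rfl
  have hcases := exists_mem_atoms_le_ofCounts
    _ (hopp 1 3 (by decide) (by decide) (by decide) (by decide))
    _ (hopp 5 7 (by decide) (by decide) (by decide) (by decide))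
    (A.count (elt 2), A.count (elt 4), A.count (elt 6)) (by
      simp only [Finset.mem_product, Finset.mem_range]
      exact ⟨hcount 2 2 (by decide), hcount 4 2 (by decide), hcount 6 2 (by decide)⟩)
  rw [hA'] at hcases
  obtain h | ⟨U, hU, hle⟩ := hcases hA
  · exact h0 h
  · exact hno U hU hle

theorem isMinZeroSum_iff_mem_atoms {U : Multiset C2C4} : IsMinZeroSum U ↔ U ∈ atoms := by
  have hatoms : ∀ U ∈ atoms, U ≠ 0 ∧ U.sum = 0 ∧ ∀ V ∈ atoms, V ≤ U → V = U := by decide +kernel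
  constructor
  · intro hU
    obtain ⟨V, hV, hle⟩ := exists_mem_atoms_le hU.ne_zero hU.sum_eq_zero
    obtain ⟨hV0, hVs, -⟩ := hatoms V hV
    exact hU.eq_of_le V hle hV0 hVs ▸ hV
  · intro hU
    obtain ⟨hU0, hUs, hmin⟩ := hatoms U hU
    refine ⟨hU0, hUs, fun V hV hV0 hVs => ?_⟩
    obtain ⟨W, hW, hle⟩ := exists_mem_atoms_le hV0 hVs
    exact le_antisymm hV (hmin W hW (hle.trans hV) ▸ hle)

/-- Searches for a factorization of `A` into `n` members of `l`; discarding the members of `l` that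
do not divide `A` keeps the search short. -/
def hasLength (l : List (Multiset C2C4)) : ℕ → Multiset C2C4 → Prop
  | 0, A => A = 0
  | 1, A => A ∈ l
  | n + 2, A => ∃ U ∈ l.filter (· ≤ A), hasLength (l.filter (· ≤ A)) (n + 1) (A - U)

theorem hasLength_iff {l : List (Multiset C2C4)} {n : ℕ} {A : Multiset C2C4}
    (hl : ∀ U ≤ A, U ∈ l ↔ IsMinZeroSum U) : hasLength l n A ↔ n ∈ lengths A := by
  match n with
  | 0 => exact zero_mem_lengths.symm
  | 1 => exact (hl A le_rfl).trans one_mem_lengths.symm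
  | n + 2 =>
    have hl' (U : Multiset C2C4) : U ∈ l.filter (· ≤ A) ↔ IsMinZeroSum U ∧ U ≤ A := by
      rw [List.mem_filter, decide_eq_true_iff]
      exact and_congr_left (hl U)
    rw [hasLength, succ_mem_lengths]
    refine exists_congr fun U => ?_
    rw [hl', and_assoc,
      hasLength_iff fun V hV => (hl' V).trans (and_iff_left (hV.trans tsub_le_self))]

instance decidableHasLength : ∀ (l : List (Multiset C2C4)) (n : ℕ) (A : Multiset C2C4),
    Decidable (hasLength l n A)
  | _, 0, _ => inferInstanceAs (Decidable (_ = _))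
  | l, 1, A => inferInstanceAs (Decidable (A ∈ l))
  | l, n + 2, A =>
    have (B : Multiset C2C4) : Decidable (hasLength (l.filter (· ≤ A)) (n + 1) B) :=
      decidableHasLength _ _ B
    inferInstanceAs (Decidable
      (∃ U ∈ l.filter (· ≤ A), hasLength (l.filter (· ≤ A)) (n + 1) (A - U)))

instance decidableMemLengths (n : ℕ) (A : Multiset C2C4) : Decidable (n ∈ lengths A) :=
  decidable_of_iff (hasLength atoms n A) (hasLength_iff fun _ _ => isMinZeroSum_iff_mem_atoms.symm)

/-! ### Long atoms containing opposite elements -/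

/-- The automorphism `(a, b) ↦ (a + b, b)`: it exchanges `1` and `5`. -/
def shearFst : C2C4 ≃+ C2C4 where
  toFun x := if x + x = 0 then x else x + elt 4
  invFun x := if x + x = 0 then x else x + elt 4
  left_inv := by decide
  right_inv := by decide
  map_add' := by decide

/-- The automorphism `(a, b) ↦ (a, b + 2a)`: it fixes `1` and exchanges `5` and `7`. -/
def shearSnd : C2C4 ≃+ C2C4 where
  toFun x := if x.1 = 0 then x else x + elt 2
  invFun x := if x.1 = 0 then x else x + elt 2
  left_inv := by decide
  right_inv := by decide
  map_add' := by decide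

/-- The automorphism group of `C₂ ⊕ C₄`, which is dihedral of order eight. -/
def automorphisms : List (C2C4 ≃+ C2C4) :=
  let φ := shearFst
  let ψ := shearSnd
  [.refl C2C4, φ, ψ, φ.trans ψ, ψ.trans φ, φ.trans (ψ.trans φ), ψ.trans (φ.trans ψ),
    φ.trans (ψ.trans (φ.trans ψ))]

/-- Representatives of the atoms of length at least three up to automorphisms. -/
def longAtomRepresentatives : List (Multiset C2C4) :=
  [[1, 1, 2], [1, 4, 7], [2, 4, 6], [1, 1, 1, 1], [1, 1, 5, 5], [1, 1, 4, 6], [1, 2, 4, 5],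
    [1, 1, 1, 6, 7]].map seq

theorem exists_map_mem_longAtomRepresentatives : ∀ U ∈ atoms, 2 < U.card →
    ∃ φ ∈ automorphisms, U.map φ ∈ longAtomRepresentatives := by
  decide +kernel

/-- Up to automorphisms, these are the stable factorizations consisting of two atoms `U`, `V` of
length at least three which contain opposite elements, see `exists_map_mem_exceptionalPairs`. -/
def exceptionalPairs : List (Multiset (Multiset C2C4)) :=
  [{seq [1, 1, 1, 1], seq [3, 3, 3, 3]}, {seq [3, 3, 3, 3], seq [1, 1, 1, 6, 7]},
    {seq [1, 1, 5, 5], seq [3, 3, 7, 7]}, {seq [1, 1, 4, 6], seq [3, 3, 4, 6]},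
    {seq [1, 1, 1, 6, 7], seq [3, 3, 3, 5, 6]}]

set_option synthInstance.maxHeartbeats 400000 in
-- Instance search for the nested bounded quantifiers exceeds the default limit.
theorem exchange_or_mem_exceptionalPairs : ∀ U ∈ longAtomRepresentatives, ∀ V ∈ atoms,
    2 < V.card → (∃ x ∈ U, -x ∈ V) →
      (∃ x ∈ U, -x ∈ V ∧ U.erase x + V.erase (-x) ∈ atoms) ∨
      (∃ φ ∈ automorphisms, {U.map φ, V.map φ} ∈ exceptionalPairs) ∨ 3 ∈ lengths (U + V) := by
  decide +kernel

theorem IsStableFactorization.erase_add_erase_notMem {U V : Multiset C2C4} {x : C2C4}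
    (h : IsStableFactorization {U, V}) (hU : 2 < U.card) (hV : 2 < V.card) (hxU : x ∈ U)
    (hxV : -x ∈ V) : U.erase x + V.erase (-x) ∉ atoms := by
  intro hmem
  have hpair : ∀ W ∈ atoms, 2 < W.card → ∀ x ∈ W, {x, -x} ∈ atoms := by decide +kernel
  have hUA : U ∈ atoms := isMinZeroSum_iff_mem_atoms.1 (h.isMinZeroSum U (by simp))
  have hle := h.pairCount_le {{x, -x}, U.erase x + V.erase (-x)} ?_ ?_ rfl
  · simp [pairCount, Multiset.countP_cons, ← Multiset.cons_zero, hU.ne', hV.ne'] at hle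
  · simpa [isMinZeroSum_iff_mem_atoms, hmem] using hpair U hUA hU x hxU
  · obtain ⟨U, rfl⟩ := Multiset.exists_cons_of_mem hxU
    obtain ⟨V, rfl⟩ := Multiset.exists_cons_of_mem hxV
    rw [Multiset.erase_cons_head, Multiset.erase_cons_head]
    simp only [Multiset.insert_eq_cons, ← Multiset.singleton_add, Multiset.sum_add,
      Multiset.sum_singleton]
    abel

theorem exists_map_mem_exceptionalPairs {U V : Multiset C2C4} (h : IsStableFactorization {U, V})
    (hU : 2 < U.card) (hV : 2 < V.card) (hopp : ∃ x ∈ U, -x ∈ V) :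
    ∃ φ : C2C4 ≃+ C2C4, {U.map φ, V.map φ} ∈ exceptionalPairs := by
  have hUA : U ∈ atoms := isMinZeroSum_iff_mem_atoms.1 (h.isMinZeroSum U (by simp))
  obtain ⟨φ, -, hφ⟩ := exists_map_mem_longAtomRepresentatives U hUA hU
  have hφs : IsStableFactorization {U.map φ, V.map φ} := by simpa using h.map φ
  have hVA : V.map φ ∈ atoms := isMinZeroSum_iff_mem_atoms.1 (hφs.isMinZeroSum _ (by simp))
  have hopp' : ∃ x ∈ U.map φ, -x ∈ V.map φ := by
    obtain ⟨x, hxU, hxV⟩ := hopp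
    exact ⟨φ x, Multiset.mem_map_of_mem _ hxU, map_neg φ x ▸ Multiset.mem_map_of_mem _ hxV⟩
  obtain ⟨x, hxU, hxV, hx⟩ | ⟨ψ, -, hψ⟩ | h3 :=
    exchange_or_mem_exceptionalPairs _ hφ _ hVA (by simpa) hopp'
  · exact absurd hx (hφs.erase_add_erase_notMem (by simpa) (by simpa) hxU hxV)
  · exact ⟨φ.trans ψ, by simpa [Multiset.map_map] using hψ⟩
  · exact absurd (by simpa using h3) hφs.succ_notMem

/-- A weight under which every atom has weight at least `4`, while the long atoms containing
neither `x` nor `y` are of weight `4`, apart from those of weight `6` containing `y - x`. Here `x`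
and `y` have order four and `y ≠ ±x`. -/
def polarWeight (x y g : C2C4) : ℕ :=
  if g = 0 then 4 else if g + g = 0 then 2 else if g = x ∨ g = y then 3 else 1

theorem four_le_polarWeight : ∀ x ∈ [elt 1, elt 3], ∀ y ∈ [elt 5, elt 7], ∀ U ∈ atoms,
    4 ≤ weight (polarWeight x y) U := by
  decide +kernel

theorem polarWeight_le_four : ∀ x ∈ [elt 1, elt 3], ∀ y ∈ [elt 5, elt 7], ∀ U ∈ atoms,
    (2 < U.card → x ∉ U ∧ y ∉ U) → ¬ (2 < U.card ∧ y - x ∈ U) →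
      weight (polarWeight x y) U ≤ 4 := by
  decide +kernel

theorem polarWeight_le_six : ∀ x ∈ [elt 1, elt 3], ∀ y ∈ [elt 5, elt 7], ∀ U ∈ atoms,
    x ∉ U ∧ y ∉ U → weight (polarWeight x y) U ≤ 6 := by
  decide +kernel

theorem exists_notMem_of_not_opposed {Z : Multiset (Multiset C2C4)} (hZ : ∀ U ∈ Z, IsMinZeroSum U)
    (hopp : ∀ U V, {U, V} ≤ Z → 2 < U.card → 2 < V.card → ∀ x ∈ U, -x ∉ V) {x y : C2C4}
    (hxy : y = -x) (hno : ∀ U ∈ atoms, 2 < U.card → x ∈ U → y ∉ U) :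
    ∃ z ∈ [x, y], ∀ U ∈ Z, 2 < U.card → z ∉ U := by
  by_contra! h
  obtain ⟨U, hU, hU2, hxU⟩ := h x (by simp)
  obtain ⟨V, hV, hV2, hyV⟩ := h y (by simp)
  obtain ⟨R, rfl⟩ := Multiset.exists_cons_of_mem hU
  obtain rfl | hVR := Multiset.mem_cons.1 hV
  · exact hno V (isMinZeroSum_iff_mem_atoms.1 (hZ V hV)) hU2 hxU hyV
  · exact hopp U V (Multiset.cons_le_cons U (Multiset.singleton_le.2 hVR)) hU2 hV2 x hxU (hxy ▸ hyV)

theorem le_card_of_not_opposed {Z : Multiset (Multiset C2C4)} (hZ : ∀ U ∈ Z, IsMinZeroSum U)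
    (hopp : ∀ U V, {U, V} ≤ Z → 2 < U.card → 2 < V.card → ∀ x ∈ U, -x ∉ V) {l : ℕ}
    (hl : l ∈ lengths Z.sum) : l ≤ Z.card := by
  have hZA : ∀ U ∈ Z, U ∈ atoms := fun U hU => isMinZeroSum_iff_mem_atoms.1 (hZ U hU)
  obtain ⟨x, hx, hxZ⟩ : ∃ x ∈ [elt 1, elt 3], ∀ U ∈ Z, 2 < U.card → x ∉ U :=
    exists_notMem_of_not_opposed hZ hopp (by decide) (by decide +kernel)
  obtain ⟨y, hy, hyZ⟩ : ∃ y ∈ [elt 5, elt 7], ∀ U ∈ Z, 2 < U.card → y ∉ U :=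
    exists_notMem_of_not_opposed hZ hopp (by decide) (by decide +kernel)
  have hlower : l * 4 ≤ weight (polarWeight x y) Z.sum :=
    mul_le_weight
      (fun U _ hU => four_le_polarWeight x hx y hy U (isMinZeroSum_iff_mem_atoms.1 hU)) hl
  have hupper : ∀ Y ≤ Z, (∀ U ∈ Y, ¬ (2 < U.card ∧ y - x ∈ U)) →
      weight (polarWeight x y) Y.sum ≤ Y.card * 4 := by
    intro Y hY hYo
    rw [weight_sum, ← smul_eq_mul, ← Multiset.card_map (weight (polarWeight x y))]
    refine Multiset.sum_le_card_nsmul _ _ fun n hn => ?_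
    obtain ⟨U, hU, rfl⟩ := Multiset.mem_map.1 hn
    have hUZ := Multiset.mem_of_le hY hU
    exact polarWeight_le_four x hx y hy U (hZA U hUZ) (fun h2 => ⟨hxZ U hUZ h2, hyZ U hUZ h2⟩)
      (hYo U hU)
  by_cases hheavy : ∃ U ∈ Z, 2 < U.card ∧ y - x ∈ U
  · obtain ⟨U, hU, hU2, hmem⟩ := hheavy
    obtain ⟨R, rfl⟩ := Multiset.exists_cons_of_mem hU
    have hself : ∀ x ∈ [elt 1, elt 3], ∀ y ∈ [elt 5, elt 7], -(y - x) = y - x := by decide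
    have hR := hupper R (Multiset.le_cons_self R U) fun V hV hVo =>
      hopp U V (Multiset.cons_le_cons U (Multiset.singleton_le.2 hV)) hU2 hVo.1 (y - x) hmem
        ((hself x hx y hy).symm ▸ hVo.2)
    have hU6 := polarWeight_le_six x hx y hy U (hZA U hU) ⟨hxZ U hU hU2, hyZ U hU hU2⟩
    rw [Multiset.sum_cons, weight_add] at hlower
    rw [Multiset.card_cons]
    omega
  · have := hupper Z le_rfl fun U hU hUo => hheavy ⟨U, hU, hUo⟩
    omega

theorem sum_map_count_nsmul {α M : Type*} [DecidableEq α] [AddCommMonoid M] (f : α → M)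
    {D : List α} (hD : D.Nodup) {Z : Multiset α} (hZ : ∀ a ∈ Z, a ∈ D) :
    (D.map fun a => Z.count a • f a).sum = (Z.map f).sum := by
  rw [Finset.sum_multiset_map_count, ← List.sum_toFinset _ hD]
  refine (Finset.sum_subset (fun a ha => ?_) fun a _ ha => ?_).symm
  · exact List.mem_toFinset.2 (hZ a (Multiset.mem_toFinset.1 ha))
  · rw [Multiset.count_eq_zero.2 (by simpa using ha), zero_nsmul]

/-- The sequence `A` contains `elt p.1` at most `p.2` times for all `p` in `bounds`. -/
def Respects (A : Multiset C2C4) (bounds : List (ℕ × ℕ)) : Prop :=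
  ∀ p ∈ bounds, A.count (elt p.1) ≤ p.2

instance (A : Multiset C2C4) (bounds : List (ℕ × ℕ)) : Decidable (Respects A bounds) :=
  inferInstanceAs (Decidable (∀ p ∈ bounds, _))

theorem Respects.of_le {A B : Multiset C2C4} {bounds : List (ℕ × ℕ)} (hA : Respects A bounds)
    (hle : B ≤ A) : Respects B bounds :=
  fun p hp => (Multiset.count_le_of_le _ hle).trans (hA p hp)

/-- Turns the computation of sets of lengths into linear arithmetic with multiplicities. -/
theorem exists_multiplicities {A : Multiset C2C4} {D : List (Multiset C2C4)}
    {bounds : List (ℕ × ℕ)} (hA : Respects A bounds) (hD : D.Nodup)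
    (hmem : ∀ U ∈ atoms, Respects U bounds → U ∈ D) {l : ℕ} (hl : l ∈ lengths A) :
    ∃ c : Multiset C2C4 → ℕ, (D.map c).sum = l ∧ (D.map fun U => c U • U).sum = A := by
  obtain ⟨Z, hZ, rfl, rfl⟩ := hl
  have hZD : ∀ U ∈ Z, U ∈ D := fun U hU => hmem U (isMinZeroSum_iff_mem_atoms.1 (hZ U hU))
    (hA.of_le (Multiset.le_sum_of_mem hU))
  exact ⟨Z.count, by simpa using sum_map_count_nsmul (fun _ => (1 : ℕ)) hD hZD,
    by simpa using sum_map_count_nsmul id hD hZD⟩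

theorem add_two_mul_mem_lengths {a b t : ℕ} (ha : t ≤ a) (hb : t ≤ b) :
    a + b + 2 * t ∈ lengths (a • seq [1, 1, 1, 1] + b • seq [3, 3, 3, 3]) := by
  obtain ⟨a, rfl⟩ := Nat.exists_eq_add_of_le ha
  obtain ⟨b, rfl⟩ := Nat.exists_eq_add_of_le hb
  have h1 : 1 ∈ lengths (seq [1, 1, 1, 1]) := by decide +kernel
  have h3 : 1 ∈ lengths (seq [3, 3, 3, 3]) := by decide +kernel
  have h4 : 4 ∈ lengths (seq [1, 1, 1, 1] + seq [3, 3, 3, 3]) := by decide +kernel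
  have h := add_mem_lengths (nsmul_mem_lengths h4 t)
    (add_mem_lengths (nsmul_mem_lengths h1 a) (nsmul_mem_lengths h3 b))
  rw [nsmul_add, add_add_add_comm, ← add_nsmul, ← add_nsmul] at h
  convert h using 1
  ring

theorem mem_lengths_family4_model {a b c l : ℕ} (hl : l ∈ lengths (seq [1, 1, 1, 6, 7] +
    seq [3, 3, 3, 5, 6] + (a • seq [1, 1, 1, 1] + b • seq [3, 3, 3, 3]) + c • seq [6, 6])) :
    l = a + b + c + 2 ∨ a + b + c + 4 ≤ l ∧ l ≤ a + b + c + 2 * min a b + 5 := by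
  let D := [[1, 3], [5, 7], [6, 6], [1, 5, 6], [3, 6, 7], [1, 1, 1, 1], [3, 3, 3, 3],
    [1, 1, 1, 6, 7], [3, 3, 3, 5, 6]].map seq
  obtain ⟨m, rfl, hm⟩ := exists_multiplicities (D := D)
    (bounds := [(0, 0), (2, 0), (4, 0), (5, 1), (7, 1)]) (by simp +decide [Respects, seq])
    (by decide +kernel) (by decide +kernel) hl
  have hcount (n : ℕ) := congrArg (Multiset.count (elt n)) hm
  have h1 := hcount 1
  have h3 := hcount 3
  have h5 := hcount 5
  have h6 := hcount 6
  have h7 := hcount 7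
  clear hcount hm hl
  simp +decide [D, seq] at h1 h3 h5 h6 h7 ⊢
  omega

theorem lengths_family4_model (a b c : ℕ) :
    lengths (seq [1, 1, 1, 6, 7] + seq [3, 3, 3, 5, 6] + (a • seq [1, 1, 1, 1] +
      b • seq [3, 3, 3, 3]) + c • seq [6, 6]) =
      {a + b + c + 2} ∪ Set.Icc (a + b + c + 4) (a + b + c + 2 * min a b + 5) := by
  have hpair : ∀ n ∈ [2, 4, 5], n ∈ lengths (seq [1, 1, 1, 6, 7] + seq [3, 3, 3, 5, 6]) := by
    decide +kernel
  have h66 : 1 ∈ lengths (seq [6, 6]) := by decide +kernel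
  refine Set.Subset.antisymm (fun l hl => mem_lengths_family4_model hl) (fun l hl => ?_)
  obtain ⟨t, ht, n, hn, rfl⟩ : ∃ t ≤ min a b, ∃ n ∈ [2, 4, 5],
      l = n + (a + b + 2 * t) + c * 1 := by
    simp only [Set.mem_union, Set.mem_singleton_iff, Set.mem_Icc] at hl
    obtain rfl | hl := hl
    · exact ⟨0, by omega, 2, by simp, by omega⟩
    obtain ⟨s, hs | hs⟩ := Nat.even_or_odd' (l - (a + b + c + 4))
    · exact ⟨s, by omega, 4, by simp, by omega⟩
    · exact ⟨s, by omega, 5, by simp, by omega⟩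
  rw [le_min_iff] at ht
  exact add_mem_lengths (add_mem_lengths (hpair n hn) (add_two_mul_mem_lengths ht.1 ht.2))
    (nsmul_mem_lengths h66 c)

theorem lengths_family4_model_mem (a b c y : ℕ) :
    lengths (seq [1, 1, 1, 6, 7] + seq [3, 3, 3, 5, 6] + (a • seq [1, 1, 1, 1] +
      b • seq [3, 3, 3, 3]) + c • seq [6, 6] + y • seq [0]) ∈ family4 := by
  rw [show seq [0] = {0} from rfl, lengths_add_nsmul_zero, lengths_family4_model,
    mem_family4_iff, shift_union, shift_singleton, shift_Icc]
  exact ⟨y + (a + b + c + 2), _, by omega, by omega, by omega, rfl⟩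

/-! ### Gaps in sets of lengths -/

/-- The shape of a set of lengths `L` above an element `k` with `k + 1 ∉ L`, which holds unless
`L` belongs to `family4`. -/
structure IsTameGap (L : Set ℕ) (k : ℕ) : Prop where
  add_two_mem : k + 2 ∈ L
  le_two_mul : ∀ l ∈ L, ∀ l' ∈ L, l' ≤ 2 * l
  parity_or_le : (∀ l ∈ L, l % 2 = k % 2) ∨ ∀ l ∈ L, l ≤ k + 2

/-- The function on `C₂ ⊕ C₄` taking the value `v[n]` at `elt n`. -/
def ofValues (v : List ℕ) (g : C2C4) : ℕ := v.getD (4 * g.1.val + g.2.val) 0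

/-- A weight which is `4` modulo `8` on the atoms satisfying one of the `parityBounds`. -/
def parityWeight : C2C4 → ℕ := ofValues [4, 1, 0, 3, 2, 5, 2, 7]

/-- A weight between `4` and `8` on the atoms satisfying one of the `parityBounds`. -/
def skewWeight : C2C4 → ℕ := ofValues [4, 2, 2, 2, 2, 4, 2, 0]

/-- A weight between `4` and `8` on the atoms satisfying one of the `flatBounds`. -/
def flatWeight : C2C4 → ℕ := ofValues [4, 2, 2, 2, 2, 2, 2, 2]

/-- Restrictions on sequences under which all their factorizations have lengths of one parity. -/
def parityBounds : List (List (ℕ × ℕ)) :=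
  [[(2, 0), (4, 0), (5, 0), (7, 1)], [(2, 0), (4, 0), (6, 0), (5, 1), (7, 1)],
    [(2, 0), (5, 0), (6, 0), (7, 0)]]

/-- Restrictions on sequences under which no atom dividing them has length greater than four. -/
def flatBounds : List (List (ℕ × ℕ)) := [[(2, 0), (5, 0), (7, 0)], [(2, 0), (4, 0), (6, 0)]]

theorem respects_add_sum {C : Multiset C2C4} {T : List (Multiset C2C4)} {bounds : List (ℕ × ℕ)}
    (h : ∀ p ∈ bounds, C.count (elt p.1) ≤ p.2 ∧ ∀ W ∈ T, elt p.1 ∉ W)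
    {R : Multiset (Multiset C2C4)} (hR : ∀ W ∈ R, W ∈ T) : Respects (C + R.sum) bounds := by
  intro p hp
  obtain ⟨hC, hT⟩ := h p hp
  have hmem : elt p.1 ∉ R.sum := by
    rw [← Multiset.join, Multiset.mem_join]
    exact fun ⟨W, hW, hpW⟩ => hT W (hR W hW) hpW
  rwa [Multiset.count_add, Multiset.count_eq_zero.2 hmem, add_zero]

theorem isTameGap_of_parityBounds {P R : Multiset (Multiset C2C4)} {T : List (Multiset C2C4)}
    (hR : ∀ W ∈ R, W ∈ T) (hP : ∀ U ∈ P, U ∈ atoms) (hgap : P.card + 2 ∈ lengths P.sum)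
    (hT : ∀ W ∈ T, W ∈ atoms)
    (hbounds : ∃ bounds ∈ parityBounds,
      ∀ p ∈ bounds, P.sum.count (elt p.1) ≤ p.2 ∧ ∀ W ∈ T, elt p.1 ∉ W) :
    IsTameGap (lengths (P + R).sum) (P + R).card := by
  have hRlen : R.card ∈ lengths R.sum :=
    ⟨R, fun W hW => isMinZeroSum_iff_mem_atoms.2 (hT W (hR W hW)), rfl, rfl⟩
  have hPlen : P.card ∈ lengths P.sum :=
    ⟨P, fun U hU => isMinZeroSum_iff_mem_atoms.2 (hP U hU), rfl, rfl⟩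
  rw [Multiset.sum_add, Multiset.card_add]
  have hatoms : ∀ bounds ∈ parityBounds, ∀ U ∈ atoms, Respects U bounds →
      weight parityWeight U ≡ 4 [MOD 8] ∧ 4 ≤ weight skewWeight U ∧ weight skewWeight U ≤ 8 := by
    decide +kernel
  obtain ⟨bounds, hb, hbP⟩ := hbounds
  have hU (U : Multiset C2C4) (hle : U ≤ P.sum + R.sum) (hU : IsMinZeroSum U) :=
    hatoms bounds hb U (isMinZeroSum_iff_mem_atoms.1 hU) ((respects_add_sum hbP hR).of_le hle)
  refine ⟨?_, fun l hl l' hl' => ?_, Or.inl fun l hl => ?_⟩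
  · rw [add_right_comm]
    exact add_mem_lengths hgap hRlen
  · have hl4 := mul_le_weight (fun U hle h => (hU U hle h).2.1) hl'
    have hl8 := weight_le_mul (fun U hle h => (hU U hle h).2.2) hl
    omega
  · have hmod {m : ℕ} (hm : m ∈ lengths (P.sum + R.sum)) :=
      weight_modEq (fun U hle h => (hU U hle h).1) hm
    have := (hmod hl).symm.trans (hmod (add_mem_lengths hPlen hRlen))
    simp only [Nat.ModEq] at this
    omega

theorem isTameGap_of_flatBounds {P R : Multiset (Multiset C2C4)} {T : List (Multiset C2C4)}
    (hR : ∀ W ∈ R, W ∈ T) (hgap : P.card + 2 ∈ lengths P.sum)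
    (hP : weight flatWeight P.sum = (P.card + 2) * 4)
    (hT : ∀ W ∈ T, W ∈ atoms ∧ weight flatWeight W = 4)
    (hbounds : ∃ bounds ∈ flatBounds,
      ∀ p ∈ bounds, P.sum.count (elt p.1) ≤ p.2 ∧ ∀ W ∈ T, elt p.1 ∉ W) :
    IsTameGap (lengths (P + R).sum) (P + R).card := by
  have hRlen : R.card ∈ lengths R.sum :=
    ⟨R, fun W hW => isMinZeroSum_iff_mem_atoms.2 (hT W (hR W hW)).1, rfl, rfl⟩
  rw [Multiset.sum_add, Multiset.card_add]
  have hatoms : ∀ bounds ∈ flatBounds, ∀ U ∈ atoms, Respects U bounds →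
      4 ≤ weight flatWeight U ∧ weight flatWeight U ≤ 8 := by
    decide +kernel
  obtain ⟨bounds, hb, hbP⟩ := hbounds
  have hU (U : Multiset C2C4) (hle : U ≤ P.sum + R.sum) (hU : IsMinZeroSum U) :=
    hatoms bounds hb U (isMinZeroSum_iff_mem_atoms.1 hU) ((respects_add_sum hbP hR).of_le hle)
  have hlow {l : ℕ} (hl : l ∈ lengths (P.sum + R.sum)) :=
    mul_le_weight (fun U hle h => (hU U hle h).1) hl
  refine ⟨?_, fun l hl l' hl' => ?_, Or.inr fun l hl => ?_⟩
  · rw [add_right_comm]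
    exact add_mem_lengths hgap hRlen
  · have hl4 := hlow hl'
    have hl8 := weight_le_mul (fun U hle h => (hU U hle h).2) hl
    omega
  · have hRweight : weight flatWeight R.sum = R.card * 4 := by
      rw [weight_sum, Multiset.map_congr rfl fun W hW => (hT W (hR W hW)).2]
      simp
    have hl4 := hlow hl
    rw [weight_add, hP, hRweight] at hl4
    omega

theorem IsStableFactorization.mem_atoms {P R : Multiset (Multiset C2C4)}
    (hZ : IsStableFactorization (P + R)) : ∀ W ∈ R, W ∈ atoms :=
  fun W hW => isMinZeroSum_iff_mem_atoms.1 (hZ.isMinZeroSum W (Multiset.mem_add.2 (.inr hW)))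

theorem IsStableFactorization.forall_mem {P R : Multiset (Multiset C2C4)}
    (hZ : IsStableFactorization (P + R)) {S T : List (Multiset C2C4)} (hS : ∀ W ∈ R, W ∈ S)
    (hT : ∀ W ∈ S, W ∈ T ∨ P.card + 2 ∈ lengths (P.sum + W)) : ∀ W ∈ R, W ∈ T := by
  refine fun W hW => (hT W (hS W hW)).resolve_right fun h => ?_
  have hle : P + {W} ≤ P + R := add_le_add le_rfl (Multiset.singleton_le.2 hW)
  exact (hZ.of_le hle).succ_notMem (by simpa using h)

theorem forall_mem_of_forall_notMem {R : Multiset (Multiset C2C4)} {T : List (Multiset C2C4)}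
    (hR : ∀ W ∈ R, W ∈ T) {X T' : List (Multiset C2C4)} (hX : ∀ W ∈ X, W ∉ R)
    (hT : ∀ W ∈ T, W ∈ X ∨ W ∈ T') : ∀ W ∈ R, W ∈ T' :=
  fun W hW => (hT W (hR W hW)).resolve_left (hX W · hW)

theorem isTameGap_of_1155_le {Z : Multiset (Multiset C2C4)} (hZ : IsStableFactorization Z)
    (hP : {seq [1, 1, 5, 5], seq [3, 3, 7, 7]} ≤ Z) : IsTameGap (lengths Z.sum) Z.card := by
  obtain ⟨R, rfl⟩ := Multiset.le_iff_exists_add.1 hP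
  have hR := hZ.forall_mem hZ.mem_atoms (T := [[0], [1, 3], [5, 7]].map seq) (by decide +kernel)
  exact isTameGap_of_flatBounds hR (by decide +kernel) (by decide +kernel) (by decide +kernel)
    (by decide +kernel)

theorem isTameGap_of_1146_le {Z : Multiset (Multiset C2C4)} (hZ : IsStableFactorization Z)
    (hP : {seq [1, 1, 4, 6], seq [3, 3, 4, 6]} ≤ Z) : IsTameGap (lengths Z.sum) Z.card := by
  obtain ⟨R, rfl⟩ := Multiset.le_iff_exists_add.1 hP
  have hR := hZ.forall_mem hZ.mem_atoms (T := [[0], [1, 3], [4, 4], [6, 6]].map seq)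
    (by decide +kernel)
  exact isTameGap_of_flatBounds hR (by decide +kernel) (by decide +kernel) (by decide +kernel)
    (by decide +kernel)

theorem lengths_mem_family4_of_11167_33356_le {Z : Multiset (Multiset C2C4)}
    (hZ : IsStableFactorization Z) (hP : {seq [1, 1, 1, 6, 7], seq [3, 3, 3, 5, 6]} ≤ Z) :
    lengths Z.sum ∈ family4 := by
  obtain ⟨R, rfl⟩ := Multiset.le_iff_exists_add.1 hP
  have hR := hZ.forall_mem hZ.mem_atoms (T := [[1, 1, 1, 1], [3, 3, 3, 3], [6, 6], [0]].map seq)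
    (by decide +kernel)
  have hsum := sum_map_count_nsmul id (by decide +kernel) hR
  simp only [List.map_cons, List.map_nil, List.sum_cons, List.sum_nil, id, add_zero,
    Multiset.map_id', ← add_assoc] at hsum
  rw [Multiset.sum_add, ← hsum, Multiset.insert_eq_cons, Multiset.sum_cons,
    Multiset.sum_singleton, ← add_assoc, ← add_assoc]
  exact lengths_family4_model_mem _ _ _ _

theorem mem_family4_or_isTameGap_of_11167_le {Z : Multiset (Multiset C2C4)}
    (hZ : IsStableFactorization Z) (hP : {seq [3, 3, 3, 3], seq [1, 1, 1, 6, 7]} ≤ Z) :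
    lengths Z.sum ∈ family4 ∨ IsTameGap (lengths Z.sum) Z.card := by
  by_cases hmem : seq [3, 3, 3, 5, 6] ∈ Z
  · refine .inl (lengths_mem_family4_of_11167_33356_le hZ ?_)
    refine (Multiset.le_iff_subset (by decide +kernel)).2 fun W hW => ?_
    obtain rfl | rfl : W = seq [1, 1, 1, 6, 7] ∨ W = seq [3, 3, 3, 5, 6] := by simpa using hW
    · exact Multiset.mem_of_le hP (by simp)
    · exact hmem
  · obtain ⟨R, rfl⟩ := Multiset.le_iff_exists_add.1 hP
    have hR := hZ.forall_mem hZ.mem_atoms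
      (T := [[0], [1, 3], [6, 6], [1, 1, 1, 1], [3, 3, 3, 3], [3, 3, 3, 5, 6]].map seq)
      (by decide +kernel)
    have hR' : ∀ W ∈ R, W ∈ [[0], [1, 3], [6, 6], [1, 1, 1, 1], [3, 3, 3, 3]].map seq :=
      forall_mem_of_forall_notMem hR (X := [seq [3, 3, 3, 5, 6]])
        (by simpa using fun h => hmem (Multiset.mem_add.2 (.inr h))) (by decide +kernel)
    exact .inr (isTameGap_of_parityBounds hR' (by decide +kernel) (by decide +kernel)
      (by decide +kernel) (by decide +kernel))

theorem mem_family4_or_isTameGap_of_five_letter_mem {R : Multiset (Multiset C2C4)}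
    (hZ : IsStableFactorization ({seq [1, 1, 1, 1], seq [3, 3, 3, 3]} + R)) {W : Multiset C2C4}
    (hW : W ∈ R)
    (hmem : W ∈ [[1, 1, 1, 4, 5], [1, 1, 1, 6, 7], [3, 3, 3, 4, 7], [3, 3, 3, 5, 6]].map seq) :
    lengths ({seq [1, 1, 1, 1], seq [3, 3, 3, 3]} + R).sum ∈ family4 ∨
      IsTameGap (lengths ({seq [1, 1, 1, 1], seq [3, 3, 3, 3]} + R).sum)
        ({seq [1, 1, 1, 1], seq [3, 3, 3, 3]} + R).card := by
  have hmap : ∀ W ∈ [[1, 1, 1, 4, 5], [1, 1, 1, 6, 7], [3, 3, 3, 4, 7], [3, 3, 3, 5, 6]].map seq,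
      ∃ φ ∈ automorphisms, ∃ V ∈ [seq [1, 1, 1, 1], seq [3, 3, 3, 3]],
        {V.map φ, W.map φ} = ({seq [3, 3, 3, 3], seq [1, 1, 1, 6, 7]} : Multiset _) := by
    decide +kernel
  obtain ⟨φ, -, V, hV, hφ⟩ := hmap W hmem
  have hle : {V, W} ≤ {seq [1, 1, 1, 1], seq [3, 3, 3, 3]} + R :=
    add_le_add (Multiset.singleton_le.2 (by simpa using hV)) (Multiset.singleton_le.2 hW)
  have hφle := Multiset.map_le_map (f := Multiset.map φ) hle
  rw [Multiset.insert_eq_cons, Multiset.map_cons, Multiset.map_singleton,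
    ← Multiset.insert_eq_cons, hφ] at hφle
  simpa only [sum_map_map, lengths_map, Multiset.card_map] using
    mem_family4_or_isTameGap_of_11167_le (hZ.map φ) hφle

theorem IsStableFactorization.three_letter_notMem {R : Multiset (Multiset C2C4)}
    (hZ : IsStableFactorization ({seq [1, 1, 1, 1], seq [3, 3, 3, 3]} + R)) :
    ∀ W ∈ [[1, 4, 7], [1, 5, 6], [3, 4, 5], [3, 6, 7]].map seq, W ∉ R := by
  have hexchange : ∀ W ∈ [[1, 4, 7], [1, 5, 6], [3, 4, 5], [3, 6, 7]].map seq, 2 < W.card ∧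
      ∃ V ∈ [seq [1, 1, 1, 1], seq [3, 3, 3, 3]], 2 < V.card ∧
        ∃ x ∈ V, -x ∈ W ∧ V.erase x + W.erase (-x) ∈ atoms := by
    decide +kernel
  intro W hWmem hW
  obtain ⟨hW2, V, hV, hV2, x, hxV, hxW, hmem⟩ := hexchange W hWmem
  refine (hZ.of_le ?_).erase_add_erase_notMem hV2 hW2 hxV hxW hmem
  exact add_le_add (Multiset.singleton_le.2 (by simpa using hV)) (Multiset.singleton_le.2 hW)

theorem isTameGap_of_57_mem {R : Multiset (Multiset C2C4)}
    (hZ : IsStableFactorization ({seq [1, 1, 1, 1], seq [3, 3, 3, 3]} + R))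
    (hR : ∀ W ∈ R, W ∈ [[0], [1, 3], [5, 7], [4, 4], [6, 6], [1, 1, 1, 1], [3, 3, 3, 3]].map seq)
    (h57 : seq [5, 7] ∈ R) :
    IsTameGap (lengths ({seq [1, 1, 1, 1], seq [3, 3, 3, 3]} + R).sum)
      ({seq [1, 1, 1, 1], seq [3, 3, 3, 3]} + R).card := by
  obtain ⟨R, rfl⟩ := Multiset.exists_cons_of_mem h57
  rw [← Multiset.singleton_add, ← add_assoc] at hZ ⊢
  rw [Multiset.forall_mem_cons] at hR
  have hR' := hZ.forall_mem hR.2 (T := [[0], [1, 3], [5, 7], [1, 1, 1, 1], [3, 3, 3, 3]].map seq)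
    (by decide +kernel)
  by_cases h57' : seq [5, 7] ∈ R
  · obtain ⟨R, rfl⟩ := Multiset.exists_cons_of_mem h57'
    rw [← Multiset.singleton_add, ← add_assoc] at hZ ⊢
    rw [Multiset.forall_mem_cons] at hR'
    exact isTameGap_of_flatBounds
      (hZ.forall_mem hR'.2 (T := [[0], [1, 3], [5, 7]].map seq) (by decide +kernel))
      (by decide +kernel) (by decide +kernel) (by decide +kernel) (by decide +kernel)
  · exact isTameGap_of_parityBounds
      (forall_mem_of_forall_notMem hR' (X := [seq [5, 7]])
        (T' := [[0], [1, 3], [1, 1, 1, 1], [3, 3, 3, 3]].map seq) (by simpa using h57')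
        (by decide +kernel))
      (by decide +kernel) (by decide +kernel) (by decide +kernel) (by decide +kernel)

theorem isTameGap_of_57_notMem {R : Multiset (Multiset C2C4)}
    (hZ : IsStableFactorization ({seq [1, 1, 1, 1], seq [3, 3, 3, 3]} + R))
    (hR : ∀ W ∈ R, W ∈ [[0], [1, 3], [4, 4], [6, 6], [1, 1, 1, 1], [3, 3, 3, 3]].map seq) :
    IsTameGap (lengths ({seq [1, 1, 1, 1], seq [3, 3, 3, 3]} + R).sum)
      ({seq [1, 1, 1, 1], seq [3, 3, 3, 3]} + R).card := by
  by_cases h44 : seq [4, 4] ∈ R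
  · by_cases h66 : seq [6, 6] ∈ R
    · obtain ⟨R, rfl⟩ := Multiset.exists_cons_of_mem h44
      have h66' : seq [6, 6] ∈ R := (Multiset.mem_cons.1 h66).resolve_left (by decide)
      obtain ⟨R, rfl⟩ := Multiset.exists_cons_of_mem h66'
      simp only [← Multiset.singleton_add, ← add_assoc] at hZ ⊢
      simp only [Multiset.forall_mem_cons] at hR
      exact isTameGap_of_flatBounds
        (hZ.forall_mem hR.2.2 (T := [[0], [1, 3], [4, 4], [6, 6]].map seq) (by decide +kernel))
        (by decide +kernel) (by decide +kernel) (by decide +kernel) (by decide +kernel)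
    · exact isTameGap_of_parityBounds
        (forall_mem_of_forall_notMem hR (X := [seq [6, 6]])
          (T' := [[0], [1, 3], [4, 4], [1, 1, 1, 1], [3, 3, 3, 3]].map seq) (by simpa using h66)
          (by decide +kernel))
        (by decide +kernel) (by decide +kernel) (by decide +kernel) (by decide +kernel)
  · exact isTameGap_of_parityBounds
      (forall_mem_of_forall_notMem hR (X := [seq [4, 4]])
        (T' := [[0], [1, 3], [6, 6], [1, 1, 1, 1], [3, 3, 3, 3]].map seq) (by simpa using h44)
        (by decide +kernel))
      (by decide +kernel) (by decide +kernel) (by decide +kernel) (by decide +kernel)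

theorem mem_family4_or_isTameGap_of_1111_le {Z : Multiset (Multiset C2C4)}
    (hZ : IsStableFactorization Z) (hP : {seq [1, 1, 1, 1], seq [3, 3, 3, 3]} ≤ Z) :
    lengths Z.sum ∈ family4 ∨ IsTameGap (lengths Z.sum) Z.card := by
  obtain ⟨R, rfl⟩ := Multiset.le_iff_exists_add.1 hP
  let short := [[0], [1, 3], [5, 7], [4, 4], [6, 6], [1, 1, 1, 1], [3, 3, 3, 3]].map seq
  let threeLetter := [[1, 4, 7], [1, 5, 6], [3, 4, 5], [3, 6, 7]].map seq
  let fiveLetter := [[1, 1, 1, 4, 5], [1, 1, 1, 6, 7], [3, 3, 3, 4, 7], [3, 3, 3, 5, 6]].map seq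
  by_cases hfive : ∃ W ∈ fiveLetter, W ∈ R
  · obtain ⟨W, hmem, hW⟩ := hfive
    exact mem_family4_or_isTameGap_of_five_letter_mem hZ hW hmem
  have hR : ∀ W ∈ R, W ∈ short := forall_mem_of_forall_notMem
    (forall_mem_of_forall_notMem
      (hZ.forall_mem hZ.mem_atoms (T := fiveLetter ++ (threeLetter ++ short)) (by decide +kernel))
      (fun W hW h => hfive ⟨W, hW, h⟩) (fun W => List.mem_append.1))
    hZ.three_letter_notMem (fun W => List.mem_append.1)
  refine .inr ?_
  by_cases h57 : seq [5, 7] ∈ R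
  · exact isTameGap_of_57_mem hZ hR h57
  · exact isTameGap_of_57_notMem hZ
      (forall_mem_of_forall_notMem hR (X := [seq [5, 7]]) (by simpa using h57) (by decide +kernel))

theorem mem_family4_or_isTameGap {A : Multiset C2C4} {k l : ℕ} (hk : k ∈ lengths A)
    (hk' : k + 1 ∉ lengths A) (hl : l ∈ lengths A) (hkl : k < l) :
    lengths A ∈ family4 ∨ IsTameGap (lengths A) k := by
  obtain ⟨Z, hZ, rfl, rfl⟩ := exists_isStableFactorization hk hk'
  obtain ⟨U, V, hUV, hU, hV, hopp⟩ : ∃ U V, {U, V} ≤ Z ∧ 2 < U.card ∧ 2 < V.card ∧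
      ∃ x ∈ U, -x ∈ V := by
    by_contra! h
    exact hkl.not_ge (le_card_of_not_opposed hZ.isMinZeroSum h hl)
  obtain ⟨φ, hφ⟩ := exists_map_mem_exceptionalPairs (hZ.of_le hUV) hU hV hopp
  have hφZ := hZ.map φ
  have hle : {U.map φ, V.map φ} ≤ Z.map (Multiset.map φ) := by
    simpa using Multiset.map_le_map (f := Multiset.map φ) hUV
  rw [← lengths_map φ, ← sum_map_map, ← Multiset.card_map (Multiset.map φ) Z]
  simp only [exceptionalPairs, List.mem_cons, List.not_mem_nil, or_false] at hφ
  obtain h | h | h | h | h := hφ <;> rw [h] at hle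
  · exact mem_family4_or_isTameGap_of_1111_le hφZ hle
  · exact mem_family4_or_isTameGap_of_11167_le hφZ hle
  · exact .inr (isTameGap_of_1155_le hφZ hle)
  · exact .inr (isTameGap_of_1146_le hφZ hle)
  · exact .inl (lengths_mem_family4_of_11167_33356_le hφZ hle)

theorem mem_family3_of_parity {L : Set ℕ} {m M : ℕ} (hm : IsLeast L m) (hM : IsGreatest L M)
    (hlt : m < M) (hle : M ≤ 2 * m) (hparity : ∀ l ∈ L, l % 2 = m % 2)
    (hstep : ∀ l ∈ L, l < M → l + 2 ∈ L) : L ∈ family3 := by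
  have hmem (i : ℕ) (hi : m + 2 * i ≤ M) : m + 2 * i ∈ L := by
    induction i with
    | zero => exact hm.1
    | succ i ih => exact hstep (m + 2 * i) (ih (by omega)) (by omega)
  refine mem_family3_iff.2 ⟨m, M, hlt, hle, hparity M hM.1, Set.ext fun x => ?_⟩
  refine ⟨fun hx => ⟨hm.2 hx, hM.2 hx, hparity x hx⟩, fun ⟨hmx, hxM, hx⟩ => ?_⟩
  have := hmem ((x - m) / 2) (by omega)
  rwa [show m + 2 * ((x - m) / 2) = x by omega] at this

theorem mem_family3_or_family5_of_top_gap {L : Set ℕ} {m k : ℕ} (hm : IsLeast L m)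
    (hM : IsGreatest L (k + 2)) (hk : k ∈ L) (hk' : k + 1 ∉ L) (hle : k + 2 ≤ 2 * m)
    (hstep : ∀ l ∈ L, l < k → l + 1 ∈ L) : L ∈ family3 ∪ family5 := by
  have hL : L = Set.Icc m k ∪ {k + 2} := by
    refine Set.Subset.antisymm (fun x hx => ?_) (Set.union_subset
      (Icc_subset_of_step hm.1 fun l hl _ hlk => hstep l hl hlk) (by simpa using hM.1))
    have hxm := hm.2 hx
    have hxM := hM.2 hx
    have hxk : x ≠ k + 1 := fun h => hk' (h ▸ hx)
    simp only [Set.mem_union, Set.mem_Icc, Set.mem_singleton_iff]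
    omega
  obtain rfl | hlt := (hm.2 hk).eq_or_lt
  · refine .inl (mem_family3_iff.2 ⟨m, m + 2, by omega, hle, by omega, ?_⟩)
    rw [hL]
    ext x
    simp only [Set.mem_union, Set.mem_Icc, Set.mem_singleton_iff, Set.mem_ofPred_eq]
    omega
  · exact .inr (mem_family5_iff.2 ⟨m, k, hlt, hle, hL⟩)

theorem mem_family1_or_family2_of_step {L : Set ℕ} {m M : ℕ} (hm : IsLeast L m)
    (hM : IsGreatest L M) (hle : 2 * M ≤ 5 * m) (hone : 1 ∈ L → L = {1})
    (hthree : 2 ∈ L → 5 ∈ L → 3 ∉ L) (hstep : ∀ l ∈ L, l < M → l + 1 ∈ L) :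
    L ∈ family1 ∪ family2 := by
  have hL : L = Set.Icc m M := Set.Subset.antisymm (fun x hx => ⟨hm.2 hx, hM.2 hx⟩)
    (Icc_subset_of_step hm.1 fun l hl _ hlM => hstep l hl hlM)
  obtain rfl | hlt := (hm.2 hM.1).eq_or_lt
  · exact .inl ⟨m, by rw [hL, Set.Icc_self]⟩
  refine .inr (mem_family2_iff.2 ⟨m, M, hlt, hle, ?_, ?_, hL⟩)
  · rintro rfl
    have := hM.1
    rw [hone hm.1, Set.mem_singleton_iff] at this
    omega
  · rintro ⟨rfl, rfl⟩
    exact hthree hm.1 hM.1 (hstep 2 hm.1 (by omega))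

theorem mem_families_of_gaps {L : Set ℕ} (hne : L.Nonempty) (hbdd : BddAbove L)
    (hratio : ∀ l ∈ L, ∀ l' ∈ L, 2 * l' ≤ 5 * l) (hone : 1 ∈ L → L = {1})
    (hthree : 2 ∈ L → 5 ∈ L → 3 ∉ L)
    (hgap : ∀ k ∈ L, k + 1 ∉ L → ∀ l ∈ L, k < l → L ∈ family4 ∨ IsTameGap L k) :
    L ∈ family1 ∪ family2 ∪ family3 ∪ family4 ∪ family5 := by
  obtain ⟨m, hm⟩ : ∃ m, IsLeast L m := ⟨_, Nat.sInf_mem hne, fun _ => Nat.sInf_le⟩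
  obtain ⟨M, hM⟩ : ∃ M, IsGreatest L M := ⟨_, Nat.sSup_mem hne hbdd, fun _ => le_csSup hbdd⟩
  by_cases h4 : L ∈ family4
  · exact .inl (.inr h4)
  have htame (k) (hk : k ∈ L) (hk' : k + 1 ∉ L) (hkM : k < M) : IsTameGap L k :=
    (hgap k hk hk' M hM.1 hkM).resolve_left h4
  by_cases hstep : ∀ l ∈ L, l < M → l + 1 ∈ L
  · exact .inl (.inl (.inl
      (mem_family1_or_family2_of_step hm hM (hratio m hm.1 M hM.1) hone hthree hstep)))
  push Not at hstep
  obtain ⟨k, hk, hkM, hk'⟩ := hstep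
  have hle := (htame k hk hk' hkM).le_two_mul m hm.1 M hM.1
  by_cases hparity : ∀ l ∈ L, l % 2 = m % 2
  · refine .inl (.inl (.inr (mem_family3_of_parity hm hM ((hm.2 hk).trans_lt hkM) hle hparity
      fun l hl hlM => (htame l hl (fun hl' => ?_) hlM).add_two_mem)))
    have h1 := hparity l hl
    have h2 := hparity _ hl'
    omega
  have htop (k) (hk : k ∈ L) (hk' : k + 1 ∉ L) (hkM : k < M) : M = k + 2 := by
    have ht := htame k hk hk' hkM
    refine le_antisymm (ht.parity_or_le.resolve_left (fun h => hparity ?_) M hM.1)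
      (hM.2 ht.add_two_mem)
    exact fun l hl => (h l hl).trans (h m hm.1).symm
  obtain rfl := htop k hk hk' hkM
  refine (mem_family3_or_family5_of_top_gap hm hM hk hk' hle fun l hl hlk => ?_).elim
    (fun h => .inl (.inl (.inr h))) .inr
  by_contra hl'
  have := htop l hl hl' (by omega)
  omega

/-! ### The largest and the smallest length -/

/-- The length of a sequence with its zero terms counted twice, so that the weights of all atoms lie
between `2` and `5`. -/
def lengthWeight : C2C4 → ℕ := ofValues [2, 1, 1, 1, 1, 1, 1, 1]

theorem lengthWeight_bounds : ∀ U ∈ atoms,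
    2 ≤ weight lengthWeight U ∧ weight lengthWeight U ≤ 5 := by
  decide +kernel

theorem two_mul_le_lengthWeight {A : Multiset C2C4} {l : ℕ} (hl : l ∈ lengths A) :
    l * 2 ≤ weight lengthWeight A :=
  mul_le_weight (fun U _ hU => (lengthWeight_bounds U (isMinZeroSum_iff_mem_atoms.1 hU)).1) hl

theorem lengthWeight_le_five_mul {A : Multiset C2C4} {l : ℕ} (hl : l ∈ lengths A) :
    weight lengthWeight A ≤ l * 5 :=
  weight_le_mul (fun U _ hU => (lengthWeight_bounds U (isMinZeroSum_iff_mem_atoms.1 hU)).2) hl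

theorem three_notMem_lengths {A : Multiset C2C4} (h2 : 2 ∈ lengths A) (h5 : 5 ∈ lengths A) :
    3 ∉ lengths A := by
  have hw : weight lengthWeight A = 10 :=
    le_antisymm (lengthWeight_le_five_mul h2) (two_mul_le_lengthWeight h5)
  have hU5 : ∀ U ∈ atoms, 5 ≤ weight lengthWeight U → U.card = 5 := by decide +kernel
  -- `A` is a product of five atoms of weight `2`, all of which satisfy `-U = U`, so `-A = A`.
  have hU2 : ∀ U ∈ atoms, weight lengthWeight U ≤ 2 → U.map Neg.neg = U := by decide +kernel
  have hpairs : ∀ U ∈ atoms, U.card = 5 → ∀ V ∈ atoms, V.card = 5 →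
      (U + V).map Neg.neg = U + V → 3 ∉ lengths (U + V) := by
    decide +kernel
  have hneg : A.map Neg.neg = A := by
    obtain ⟨Z, hZ, rfl, hcard⟩ := h5
    have hfix (U) (hU : U ∈ Z) : U.map Neg.neg = U := by
      obtain ⟨R, rfl⟩ := Multiset.exists_cons_of_mem hU
      rw [Multiset.forall_mem_cons] at hZ
      rw [Multiset.card_cons] at hcard
      rw [Multiset.sum_cons, weight_add] at hw
      have := two_mul_le_lengthWeight ⟨R, hZ.2, rfl, rfl⟩
      exact hU2 U (isMinZeroSum_iff_mem_atoms.1 hZ.1) (by omega)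
    rw [← sum_map_map, Multiset.map_congr rfl hfix, Multiset.map_id']
  obtain ⟨Z, hZ, rfl, hcard⟩ := h2
  obtain ⟨U, V, rfl⟩ := Multiset.card_eq_two.1 hcard
  have hUA : U ∈ atoms := isMinZeroSum_iff_mem_atoms.1 (hZ U (by simp))
  have hVA : V ∈ atoms := isMinZeroSum_iff_mem_atoms.1 (hZ V (by simp))
  have hU := (lengthWeight_bounds U hUA).2
  have hV := (lengthWeight_bounds V hVA).2
  rw [Multiset.insert_eq_cons, Multiset.sum_cons, Multiset.sum_singleton] at hw hneg ⊢
  rw [weight_add] at hw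
  exact hpairs U hUA (hU5 U hUA (by omega)) V hVA (hU5 V hVA (by omega)) hneg

theorem lengths_mem_families {A : Multiset C2C4} (hA : A.sum = 0) :
    lengths A ∈ family1 ∪ family2 ∪ family3 ∪ family4 ∪ family5 := by
  refine mem_families_of_gaps (lengths_nonempty hA) (bddAbove_lengths A) (fun l hl l' hl' => ?_)
    (fun h => (one_mem_lengths.1 h).lengths_eq) three_notMem_lengths
    (fun k hk hk' l hl hkl => mem_family4_or_isTameGap hk hk' hl hkl)
  have h1 := lengthWeight_le_five_mul hl
  have h2 := two_mul_le_lengthWeight hl'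
  omega

/-! ### Realizing the families -/

theorem mem_lengths_family3_model {n l : ℕ}
    (hl : l ∈ lengths (n • seq [1, 1, 1, 1] + n • seq [3, 3, 3, 3])) :
    2 * n ≤ l ∧ l ≤ 4 * n ∧ l % 2 = 0 := by
  let D := [[1, 3], [1, 1, 1, 1], [3, 3, 3, 3]].map seq
  obtain ⟨m, rfl, hm⟩ := exists_multiplicities (D := D)
    (bounds := [(0, 0), (2, 0), (4, 0), (5, 0), (6, 0), (7, 0)]) (by simp +decide [Respects, seq])
    (by decide +kernel) (by decide +kernel) hl
  have h1 := congrArg (Multiset.count (elt 1)) hm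
  have h3 := congrArg (Multiset.count (elt 3)) hm
  clear hm hl
  simp +decide [D, seq] at h1 h3 ⊢
  omega

theorem lengths_family3_model (n : ℕ) :
    lengths (n • seq [1, 1, 1, 1] + n • seq [3, 3, 3, 3]) =
      shift (2 * n) (dilate 2 (Set.Icc 0 n)) := by
  refine Set.Subset.antisymm (fun l hl => ?_) ?_
  · have := mem_lengths_family3_model hl
    exact ⟨_, ⟨(l - 2 * n) / 2, by simp; omega, rfl⟩, by simp; omega⟩
  · rintro _ ⟨_, ⟨t, ht, rfl⟩, rfl⟩
    simpa [two_mul] using add_two_mul_mem_lengths ht.2 ht.2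

theorem mem_lengths_family5_model {c i l : ℕ} (hl : l ∈ lengths
    (c • seq [1, 1, 3, 3] + seq [5, 5, 7, 7] + (i • seq [1, 1, 1, 1] + i • seq [3, 3, 3, 3]))) :
    c + 2 * i + 1 ≤ l ∧ l ≤ 2 * (c + 2 * i) ∨ l = 2 * (c + 2 * i) + 2 := by
  let D := [[1, 3], [5, 7], [1, 1, 1, 1], [3, 3, 3, 3], [1, 1, 5, 5], [1, 1, 7, 7], [3, 3, 5, 5],
    [3, 3, 7, 7]].map seq
  obtain ⟨m, rfl, hm⟩ := exists_multiplicities (D := D)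
    (bounds := [(0, 0), (2, 0), (4, 0), (5, 2), (6, 0), (7, 2)]) (by simp +decide [Respects, seq])
    (by decide +kernel) (by decide +kernel) hl
  have hcount (n : ℕ) := congrArg (Multiset.count (elt n)) hm
  have h1 := hcount 1
  have h3 := hcount 3
  have h5 := hcount 5
  have h7 := hcount 7
  clear hcount hm hl
  simp +decide [D, seq] at h1 h3 h5 h7 ⊢
  lia

theorem lengths_family5_model {c : ℕ} (hc : c = 2 ∨ c = 3) (i : ℕ) : lengths
    (c • seq [1, 1, 3, 3] + seq [5, 5, 7, 7] + (i • seq [1, 1, 1, 1] + i • seq [3, 3, 3, 3])) =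
      Set.Icc (c + 2 * i + 1) (2 * (c + 2 * i)) ∪ {2 * (c + 2 * i) + 2} := by
  have hbase : ∀ c ∈ [2, 3], ∀ n ∈ [c + 1, c + 2, 2 * c, 2 * c + 2],
      n ∈ lengths (c • seq [1, 1, 3, 3] + seq [5, 5, 7, 7]) := by
    decide +kernel
  refine Set.Subset.antisymm (fun l hl => mem_lengths_family5_model hl) (fun l hl => ?_)
  obtain ⟨n, hn, t, ht, rfl⟩ : ∃ n, (n = c + 1 ∨ n = c + 2 ∨ n = 2 * c ∨ n = 2 * c + 2) ∧
      ∃ t ≤ i, l = n + (i + i + 2 * t) := by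
    simp only [Set.mem_union, Set.mem_singleton_iff, Set.mem_Icc] at hl
    by_cases htop : 2 * (c + 2 * i) ≤ l
    · exact ⟨l - 4 * i, by omega, i, le_rfl, by omega⟩
    · exact ⟨c + 1 + (l - (c + 1)) % 2, by omega, (l - (c + 1)) / 2 - i, by omega, by omega⟩
  exact add_mem_lengths (hbase c (by simpa) n (by simpa)) (add_two_mul_mem_lengths ht ht)

theorem lengths_eq_Icc {A : Multiset C2C4} {m M : ℕ} (hsub : ∀ l ≤ M, m ≤ l → l ∈ lengths A)
    (hm : 5 * m < weight lengthWeight A + 5) (hM : weight lengthWeight A < 2 * M + 2) :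
    lengths A = Set.Icc m M := by
  refine Set.Subset.antisymm (fun l hl => ?_) (fun l hl => hsub l hl.2 hl.1)
  have h1 := lengthWeight_le_five_mul hl
  have h2 := two_mul_le_lengthWeight hl
  rw [Set.mem_Icc]
  omega

theorem lengths_add_nsmul_eq_Icc {A : Multiset C2C4} {m M : ℕ} (hmM : m + 2 ≤ M)
    (hsub : ∀ l ≤ M, m ≤ l → l ∈ lengths A) (hm : 5 * m < weight lengthWeight A + 5)
    (hM : weight lengthWeight A < 2 * M + 2) (j : ℕ) :
    lengths (A + j • (seq [1, 1, 1, 6, 7] + seq [3, 3, 3, 5, 6])) =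
      Set.Icc (m + 2 * j) (M + 5 * j) := by
  have hw : weight lengthWeight (seq [1, 1, 1, 6, 7] + seq [3, 3, 3, 5, 6]) = 10 := by decide
  have h2 : 2 ∈ lengths (seq [1, 1, 1, 6, 7] + seq [3, 3, 3, 5, 6]) := by decide +kernel
  have h5 : 5 ∈ lengths (seq [1, 1, 1, 6, 7] + seq [3, 3, 3, 5, 6]) := by decide +kernel
  refine lengths_eq_Icc ?_ (by rw [weight_add, weight_nsmul, hw]; omega)
    (by rw [weight_add, weight_nsmul, hw]; omega)
  clear hm hM
  induction j with
  | zero => simpa using hsub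
  | succ j ih =>
    intro l hlM hml
    rw [succ_nsmul, ← add_assoc]
    by_cases hl : l ≤ M + 5 * j + 2
    · simpa [show l - 2 + 2 = l by omega] using
        add_mem_lengths (ih (l - 2) (by omega) (by omega)) h2
    · simpa [show l - 5 + 5 = l by omega] using
        add_mem_lengths (ih (l - 5) (by omega) (by omega)) h5

theorem mem_lengths_of_le_ten : ∀ l ≤ 10, 4 ≤ l → l ∈ lengths
    (seq [1, 1, 1, 4, 5] + seq [3, 3, 3, 4, 7] + (seq [1, 1, 1, 6, 7] + seq [3, 3, 3, 5, 6])) := by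
  intro l h10 h4
  by_cases h5 : l = 5
  · subst h5
    decide +kernel
  have hleft : ∀ n ∈ [2, 4, 5], n ∈ lengths (seq [1, 1, 1, 4, 5] + seq [3, 3, 3, 4, 7]) := by
    decide +kernel
  have hright : ∀ n ∈ [2, 4, 5], n ∈ lengths (seq [1, 1, 1, 6, 7] + seq [3, 3, 3, 5, 6]) := by
    decide +kernel
  obtain ⟨n, hn, n', hn', rfl⟩ : ∃ n ∈ [2, 4, 5], ∃ n' ∈ [2, 4, 5], l = n + n' := by
    interval_cases l <;> first | contradiction | decide
  exact add_mem_lengths (hleft n hn) (hright n' hn')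

theorem exists_lengths_eq_Icc {k : ℕ} (hk : 1 ≤ k) : ∃ (A : Multiset C2C4) (m M : ℕ),
    lengths A = Set.Icc m M ∧ M = m + k ∧
      (m = (2 * k + 2) / 3 ∨ k = 1 ∧ m = 2 ∨ k = 3 ∧ m = 3) := by
  by_cases h1 : k = 1
  · exact ⟨seq [1, 5, 6] + seq [3, 6, 7], 2, 3,
      lengths_eq_Icc (by decide +kernel) (by decide) (by decide), by omega, by omega⟩
  by_cases h3 : k = 3
  · exact ⟨seq [1, 3] + seq [1, 1, 1, 6, 7] + seq [3, 3, 3, 5, 6], 3, 6,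
      lengths_eq_Icc (by decide +kernel) (by decide) (by decide), by omega, by omega⟩
  obtain ⟨j, rfl | rfl | rfl⟩ : ∃ j, k = 3 * j + 2 ∨ k = 3 * j + 4 ∨ k = 3 * j + 6 := by
    obtain h | h | h : k % 3 = 2 ∨ k % 3 = 1 ∨ k % 3 = 0 := by omega
    · exact ⟨(k - 2) / 3, by omega⟩
    · exact ⟨(k - 4) / 3, by omega⟩
    · exact ⟨(k - 6) / 3, by omega⟩
  · exact ⟨_, _, _, lengths_add_nsmul_eq_Icc (A := seq [1, 1, 7, 7] + seq [3, 3, 3, 5, 6])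
      (m := 2) (M := 4) le_rfl (by decide +kernel) (by decide) (by decide) j, by omega, by omega⟩
  · exact ⟨_, _, _, lengths_add_nsmul_eq_Icc
      (A := seq [1, 1, 5, 5] + seq [1, 6, 7, 7, 7] + seq [3, 3, 3, 5, 6]) (m := 3) (M := 7)
      (by omega) (by decide +kernel) (by decide) (by decide) j, by omega, by omega⟩
  · exact ⟨_, _, _, lengths_add_nsmul_eq_Icc (m := 4) (M := 10)
      (by omega) mem_lengths_of_le_ten (by decide) (by decide) j, by omega, by omega⟩

theorem family1_subset (G : Type*) [AddCommGroup G] : family1 ⊆ groupSystemOfSetsOfLengths G := by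
  rintro _ ⟨y, rfl⟩
  simpa [shift_singleton] using
    shift_mem_of_lengths_eq (lengths_zero (G := G)) (Set.singleton_nonempty 0) y

theorem family2_subset : family2 ⊆ groupSystemOfSetsOfLengths C2C4 := by
  intro L hL
  obtain ⟨m, M, hmM, hle, h1, h25, rfl⟩ := mem_family2_iff.1 hL
  obtain ⟨A, m', M', hA, hM', hm'⟩ := exists_lengths_eq_Icc (k := M - m) (by omega)
  have h := shift_mem_of_lengths_eq hA (Set.nonempty_Icc.2 (by omega)) (m - m')
  rw [shift_Icc] at h
  convert h using 2 <;> omega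

theorem family3_subset : family3 ⊆ groupSystemOfSetsOfLengths C2C4 := by
  rintro _ ⟨y, k, -, rfl⟩
  rw [← shift_shift]
  exact shift_mem_of_lengths_eq (lengths_family3_model k) ⟨_, 0, ⟨0, by simp, rfl⟩, rfl⟩ y

theorem family4_subset : family4 ⊆ groupSystemOfSetsOfLengths C2C4 := by
  rintro _ ⟨y, _, ⟨j, rfl⟩, rfl⟩
  have h := shift_mem_of_lengths_eq (lengths_family4_model j j 0) ⟨_, .inl rfl⟩ y
  rw [shift_union, shift_singleton, shift_Icc] at h ⊢
  convert h using 3 <;> omega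

theorem family5_subset : family5 ⊆ groupSystemOfSetsOfLengths C2C4 := by
  rintro _ ⟨y, k, hk, rfl⟩
  have h := shift_mem_of_lengths_eq (lengths_family5_model (c := 2 + (k + 1) % 2) (by omega)
    ((k - 1) / 2)) ⟨_, .inr rfl⟩ y
  rw [shift_union, shift_singleton, shift_Icc] at h ⊢
  convert h using 3 <;> omega

theorem theorem4p7 :
    groupSystemOfSetsOfLengths (ZMod 2 × ZMod 4) =
        family1 ∪ family2 ∪ family3 ∪ family4 ∪ family5 ∧
      family2 = family2' := by
  refine ⟨Set.Subset.antisymm ?_ ?_, family2_eq⟩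
  · rintro _ ⟨a, rfl⟩
    rw [setOfLengths_eq_lengths]
    exact lengths_mem_families a.2
  · exact Set.union_subset (Set.union_subset (Set.union_subset (Set.union_subset
      (family1_subset _) family2_subset) family3_subset) family4_subset) family5_subset
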